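/- Write $\log x=\max(1,\log_2 x)$. Let $G=(V,E)$ be an undirected graph (not necessarily connected) with $|V|=n\ge 1$ whose edges have costs in $\{0,1\}$ (an unweighted graph is the case in which all costs are $1$). Let $\delta(u,v)\in\mathbb{N}\cup\{\infty\}$ be the cost of a cheapest $u$-$v$ path ($\infty$ if there is none) and, for $u,v$ in the same component, let $\ell(u,v)$ be the smallest number of edges on such a path. A *decoder* is a program of a word RAM with word size $\Theta(\log n)$ (unit-cost arithmetic, bitwise, comparison and memory operations on words) that receives two labels (bit strings) and may read one word's worth of consecutive bits of a label in one step. **Theorem.** There are one decoder and one absolute constant $C$ such that for all integers $1\le T\le n$ there is an integer $\tau\ge 1$ with $\tau\le C\log T$ and $\log T\le C\tau$, such that every graph $G$ as above on $n$ vertices has an assignment of labels to its vertices with the following properties. 1. (Size.) Every label has at most $C\,n\,\dfrac{(\log\log T)^2}{\log T}$ bits. 2. (2-additive decoding in time $T$.) For all $u,v\in V$, given the labels of $u$ and $v$ only, the decoder outputs within $\max(C,T)$ steps a value $\delta'(u,v)\in\mathbb{N}\cup\{\infty\}$ with $\delta(u,v)\le\delta'(u,v)\le\delta(u,v)+2$.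 3. (Hubs.) Let $V'=\{v:\deg(v)>\tau\}$ and $R'=\lfloor \tau/\log\tau\rfloor$. There are a set $S'\subseteq V$ that dominates $V'$ (every vertex of $V'$ is in $S'$ or has a neighbour in $S'$) and numbers $\mathrm{offset}(u)\in\{0,\dots,R'-1\}$ such that, with $B'_u(R')$ the ball of radius $R'$ (in number of edges) around $u$ in $G[V\setminus V']$ (empty if $u\in V'$), $L_u=\{v \text{ in the component of } u:\ \ell(u,v)\equiv \mathrm{offset}(u) \pmod{R'}\}$ and $S(u)=B'_u(R')\cup L_u\cup S'$, we have $|L_u|\le n/R'$ and $|S(u)|\le C\,n\,\dfrac{\log\log T}{\log T}$ for all $u$; and whenever $u,v$ are in the same component, $\delta'(u,v)=\delta(u,w)+\delta(w,v)$ for some $w\in S(u)\cap S(v)$. -/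

import Mathlib

/-! ## A word RAM with step count

A program has finitely many registers and a memory of `2 ^ w` cells, all holding `w`-bit words and
all initially zero.  Arithmetic is modulo `2 ^ w`.  The input consists of two read-only bit strings;
one instruction reads `w` consecutive bits of one of them, from any position.  Programs are built
from unit-cost instructions by sequencing, conditionals and loops. -/

namespace WordRAM

/-- The binary operations on words. -/
inductive BinOp
  | add | sub | mul | div | mod | and | or | xor | shl | shr

/-- Value of an operation on two `w`-bit words. Division by zero gives `0`, remainder modulo zero
leaves the word unchanged. -/
def BinOp.eval (w : ℕ) : BinOp → ℕ → ℕ → ℕ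
  | .add, a, b => (a + b) % 2 ^ w
  | .sub, a, b => (a + (2 ^ w - b)) % 2 ^ w
  | .mul, a, b => (a * b) % 2 ^ w
  | .div, a, b => a / b
  | .mod, a, b => a % b
  | .and, a, b => a &&& b
  | .or,  a, b => a ||| b
  | .xor, a, b => a ^^^ b
  | .shl, a, b => (a * 2 ^ b) % 2 ^ w
  | .shr, a, b => a / 2 ^ b

/-- The unit-cost instructions. Natural numbers `d a b s` are register names. -/
inductive Instr
  /-- `reg d := c` -/
  | const (d c : ℕ)
  /-- `reg d := reg a` -/
  | copy (d a : ℕ)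
  /-- `reg d := reg a ∘ reg b` -/
  | op (o : BinOp) (d a b : ℕ)
  /-- `reg d := mem (reg a)` -/
  | load (d a : ℕ)
  /-- `mem (reg a) := reg s` -/
  | store (a s : ℕ)
  /-- `reg d :=` the word of the first (`second = false`) or second input string that starts at bit
  position `reg a` -/
  | read (second : Bool) (d a : ℕ)

/-- Comparisons of two registers. -/
inductive Test
  | eq (a b : ℕ)
  | lt (a b : ℕ)

/-- Programs. -/
inductive Prog
  | skip
  | instr (i : Instr)
  | seq (p q : Prog)
  | ite (t : Test) (p q : Prog)
  | while (t : Test) (p : Prog)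

/-- Contents of the registers and of the memory. -/
structure State where
  reg : ℕ → ℕ
  mem : ℕ → ℕ

/-- The initial state: everything is zero. -/
def State.init : State := ⟨fun _ => 0, fun _ => 0⟩

def State.setReg (s : State) (d x : ℕ) : State := { s with reg := Function.update s.reg d x }

def State.setMem (s : State) (a x : ℕ) : State := { s with mem := Function.update s.mem a x }

/-- The `w` consecutive bits of `l` starting at position `p`, as a word (least significant bit
first); positions beyond the end of `l` read as `0`. -/
def readWord (w : ℕ) (l : List Bool) (p : ℕ) : ℕ :=
  ∑ i ∈ Finset.range w, if l.getD (p + i) false then 2 ^ i else 0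

/-- Effect of one instruction, for word size `w` and input strings `x`, `y`. -/
def Instr.run (w : ℕ) (x y : List Bool) (s : State) : Instr → State
  | .const d c => s.setReg d (c % 2 ^ w)
  | .copy d a => s.setReg d (s.reg a)
  | .op o d a b => s.setReg d (o.eval w (s.reg a) (s.reg b))
  | .load d a => s.setReg d (s.mem (s.reg a))
  | .store a r => s.setMem (s.reg a) (s.reg r)
  | .read second d a => s.setReg d (readWord w (if second then y else x) (s.reg a))

def Test.Holds (s : State) : Test → Prop
  | .eq a b => s.reg a = s.reg b
  | .lt a b => s.reg a < s.reg b

/-- `Exec w x y p s k s'`: with word size `w` and input strings `x`, `y`, the program `p` started in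
state `s` halts in state `s'` after exactly `k` steps. Every instruction and every evaluation of a
test is one step. -/
inductive Exec (w : ℕ) (x y : List Bool) : Prog → State → ℕ → State → Prop
  | skip (s : State) : Exec w x y .skip s 0 s
  | instr (i : Instr) (s : State) : Exec w x y (.instr i) s 1 (i.run w x y s)
  | seq {p q : Prog} {s s' s'' : State} {k k' : ℕ} :
      Exec w x y p s k s' → Exec w x y q s' k' s'' → Exec w x y (.seq p q) s (k + k') s''
  | ite_true {t : Test} {p q : Prog} {s s' : State} {k : ℕ} :
      t.Holds s → Exec w x y p s k s' → Exec w x y (.ite t p q) s (k + 1) s'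
  | ite_false {t : Test} {p q : Prog} {s s' : State} {k : ℕ} :
      ¬ t.Holds s → Exec w x y q s k s' → Exec w x y (.ite t p q) s (k + 1) s'
  | while_true {t : Test} {p : Prog} {s s' s'' : State} {k k' : ℕ} :
      t.Holds s → Exec w x y p s k s' → Exec w x y (.while t p) s' k' s'' →
      Exec w x y (.while t p) s (k + 1 + k') s''
  | while_false {t : Test} {p : Prog} {s : State} :
      ¬ t.Holds s → Exec w x y (.while t p) s 1 s

/-- Programs are deterministic: final state and number of steps are determined by the input. -/
theorem Exec.unique {w : ℕ} {x y : List Bool} {p : Prog} {s s₁ s₂ : State} {k₁ k₂ : ℕ}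
    (h₁ : Exec w x y p s k₁ s₁) (h₂ : Exec w x y p s k₂ s₂) : k₁ = k₂ ∧ s₁ = s₂ := by
  induction h₁ generalizing k₂ s₂ with
  | skip => cases h₂; exact ⟨rfl, rfl⟩
  | instr => cases h₂; exact ⟨rfl, rfl⟩
  | seq _ _ ih ih' =>
    cases h₂ with
    | seq a b => obtain ⟨rfl, rfl⟩ := ih a; obtain ⟨rfl, rfl⟩ := ih' b; exact ⟨rfl, rfl⟩
  | ite_true ht _ ih =>
    cases h₂ with
    | ite_true _ a => obtain ⟨rfl, rfl⟩ := ih a; exact ⟨rfl, rfl⟩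
    | ite_false hn _ => exact absurd ht hn
  | ite_false hn _ ih =>
    cases h₂ with
    | ite_true ht _ => exact absurd ht hn
    | ite_false _ a => obtain ⟨rfl, rfl⟩ := ih a; exact ⟨rfl, rfl⟩
  | while_true ht _ _ ih ih' =>
    cases h₂ with
    | while_true _ a b => obtain ⟨rfl, rfl⟩ := ih a; obtain ⟨rfl, rfl⟩ := ih' b; exact ⟨rfl, rfl⟩
    | while_false hn => exact absurd ht hn
  | while_false hn =>
    cases h₂ with
    | while_true ht _ _ => exact absurd ht hn
    | while_false _ => exact ⟨rfl, rfl⟩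

/-- The number in `ℕ ∪ {∞}` that a halted program outputs: register `0` holds `0` for `∞` and
`d + 1` for the number `d`. -/
def State.output (s : State) : ℕ∞ := if s.reg 0 = 0 then ⊤ else ((s.reg 0 - 1 : ℕ) : ℕ∞)

/-- With word size `w`, the program `p` on the input strings `x`, `y` outputs `d` within at most `t`
steps. -/
def OutputsWithin (w : ℕ) (p : Prog) (x y : List Bool) (t : ℕ) (d : ℕ∞) : Prop :=
  ∃ (k : ℕ) (s : State), k ≤ t ∧ Exec w x y p State.init k s ∧ s.output = d

/-- Logarithmic word size `Θ(log n)`, with constant factor `κ`. -/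
def wordSize (κ n : ℕ) : ℕ := κ * (Nat.log 2 n + 1)

end WordRAM

/-! ## Distances, hubs -/

namespace DistLabel

/-- The convention `log x = max (1, log₂ x)`. -/
noncomputable def lg (x : ℝ) : ℝ := max 1 (Real.logb 2 x)

section Graph

variable {V : Type*} (G : SimpleGraph V) (cost : Sym2 V → ℕ)

/-- Total cost of the edges of a walk, with multiplicity. -/
def walkCost {u v : V} (p : G.Walk u v) : ℕ := (p.edges.map cost).sum

/-- `δ(u, v)`: the cost of a cheapest path, `∞` if there is none. -/
noncomputable def delta (u v : V) : ℕ∞ := ⨅ p : G.Walk u v, (walkCost G cost p : ℕ∞)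

/-- With unit costs `δ` is the usual graph distance. -/
theorem delta_one (u v : V) : delta G (fun _ => 1) u v = G.edist u v := by
  simp [delta, walkCost, SimpleGraph.edist]

/-- `ℓ(u, v)`: the smallest number of edges on a cheapest path (used for reachable pairs only). -/
noncomputable def ell (u v : V) : ℕ :=
  sInf {k | ∃ p : G.Walk u v, (walkCost G cost p : ℕ∞) = delta G cost u v ∧ p.length = k}

/-- The vertices of degree greater than `τ`. -/
def highDeg (τ : ℕ) : Set V := {v | τ < (G.neighborSet v).ncard}

/-- Ball of radius `r` (in number of edges) around `u` in the subgraph induced by the vertices of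
degree at most `τ`. -/
def lowBall (τ r : ℕ) (u : V) : Set V :=
  {v | ∃ p : G.Walk u v, p.length ≤ r ∧ ∀ x ∈ p.support, x ∉ highDeg G τ}

/-- The `k`-th layer class modulo `r` of `u`: the vertices `v` with `ℓ(u, v) ≡ k (mod r)`. -/
def layer (r k : ℕ) (u : V) : Set V := {v | G.Reachable u v ∧ ell G cost u v ≡ k [MOD r]}

/-- `D` dominates the set `A`: every vertex of `A` is in `D` or has a neighbour in `D`. -/
def Dominates (D A : Set V) : Prop := ∀ v ∈ A, ∃ x ∈ D, x = v ∨ G.Adj v x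

/-- The radius `⌊τ / log τ⌋`. -/
noncomputable def radius (τ : ℕ) : ℕ := ⌊(τ : ℝ) / lg τ⌋₊

/-- The hub set of `u`: restricted ball, one layer class, and the set `D`. -/
noncomputable def hubs (τ : ℕ) (D : Set V) (offset : V → ℕ) (u : V) : Set V :=
  lowBall G τ (radius τ) u ∪ layer G cost (radius τ) (offset u) u ∪ D

end Graph

end DistLabel

/-! Let `s` be ⌊log₂ T⌋ / 16 rounded down, τ = s + 1 and R = `radius τ`. Follow a cheapest u-v path
with fewest edges backwards from v, for up to R steps. If a vertex of degree greater than τ occurs,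
the first one is v or adjacent to the restricted ball of v, and its dominator is at distance at most
1 from it, so the detour costs at most 2. Otherwise the vertices met lie in the restricted ball of
v. Either the path has fewer than R edges and the ball contains u, or R consecutive vertices have
consecutive values of ℓ(u, ·), so one of them is in the layer class kept by u. Hence some vertex of
the small set `ownHubs` of v is a hub of u (`exists_hub`). The small set has at most 2 ^ (5τ)
elements, because τ ^ R is 2 ^ O(τ), and can be enumerated in time T. The full hub set has O(n log τ
/ τ) elements: the layer class by averaging (`exists_offset`), the dominators by greedy covering
(`exists_dominating`).

A hub must cost only O(log τ) bits. Each component is traversed by a tour of fewer than 2n positions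
(`exists_tour`), along which the distance from u changes by at most 1. The tour is cut into blocks
of length B, between τ and 2τ. A hub is an entry with its position in its block and its distance
relative to the start of the block. Each block also needs a pointer to its entries and a base
distance. These sequences can be made nondecreasing with small increments, so full values are stored
only for every g-th block, together with one word of packed increments; a table gives prefix sums in
constant time (`sampled_add_digitSum`).

The decoder takes each own hub of v from the second label, finds its block in the first, scans at
most B entries, and keeps the smallest sum of the two distances (`Content.Valid.item_spec`,
`Content.Valid.decode_eq`). The triangle inequality gives the lower bound on the output,
`exists_hub` the upper bound. -/

namespace DistLabel

open WordRAM

/-! ## Straight-line programs and the decoder -/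

/-- Sequential composition of instructions. -/
def block : List Instr → Prog
  | [] => .skip
  | i :: is => .seq (.instr i) (block is)

theorem exec_block (w : ℕ) (x y : List Bool) (is : List Instr) (s : State) :
    Exec w x y (block is) s is.length (is.foldl (fun s i => i.run w x y s) s) := by
  induction is generalizing s with
  | nil => exact .skip s
  | cons i is ih =>
    have := Exec.seq (.instr (w := w) (x := x) (y := y) i s) (ih (i.run w x y s))
    rw [Nat.add_comm] at this
    exact this

/-- Reads the header: word size, component identifiers, constants, bounds of the item list. -/
def setupBlock : List Instr :=
  -- The program does not depend on the word size, so it takes it from the first word of the label.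
  -- Register 0 will hold the minimum plus one and starts at a value above every candidate.
  [.read false 1 0, .copy 8 1, .read false 19 8, .read true 20 8,
   .op .add 8 8 1, .read false 2 8, .op .add 8 8 1, .read false 3 8,
   .op .add 8 8 1, .read false 4 8, .op .add 8 8 1, .read false 5 8,
   .op .add 8 8 1, .read false 0 8, .op .add 8 8 1, .read true 6 8,
   .op .add 8 8 1, .read true 7 8]

/-- Reads the next item of the second label. -/
def itemBlock : List Instr :=
  [.read true 9 6, .op .add 6 6 1, .read true 10 6, .op .add 6 6 1, .read true 11 6,
   .op .add 6 6 1, .read true 12 6, .op .add 6 6 1, .read true 13 6, .op .add 6 6 1]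

/-- Computes one sampled prefix sum into register `d`. -/
def prefixBlock (d : ℕ) : List Instr :=
  [.read false d 9, .op .add 9 9 1, .read false 15 9, .op .mod 15 15 10, .op .mul 15 15 1,
   .op .add 15 15 5, .read false 15 15, .op .add d d 15]

/-- Reads the first entry of a group. -/
def entryBlock : List Instr := [.read false 17 14, .op .mod 18 17 3]

/-- Moves on to the next entry. -/
def stepBlock : List Instr := [.op .add 14 14 2, .read false 17 14, .op .mod 18 17 3]

/-- Computes the candidate value of a matching entry. -/
def valueBlock : List Instr :=
  [.op .mod 17 17 4, .op .div 17 17 3, .op .add 16 16 17, .op .add 16 16 12, .op .sub 16 16 13]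

/-- Scans a group. -/
def scanLoop : Prog := .while (.lt 18 11) (block stepBlock)

/-- Updates the minimum found so far. -/
def updateProg : Prog :=
  .ite (.eq 18 11) (.seq (block valueBlock) (.ite (.lt 16 0) (block [.copy 0 16]) .skip)) .skip

/-- Body of the main loop. -/
def bodyProg : Prog :=
  .seq (block itemBlock) <| .seq (block (prefixBlock 14)) <| .seq (block [.op .add 9 9 1]) <|
    .seq (block (prefixBlock 16)) <| .seq (block entryBlock) <| .seq scanLoop updateProg

/-- The decoder. -/
def decoder : Prog :=
  .seq (block setupBlock) <|
    .ite (.eq 19 20) (.while (.lt 6 7) bodyProg) (block [.const 0 0])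

/-- Constants of the scheme, kept in registers. -/
structure Consts where
  /-- width of an entry -/
  e : ℕ
  /-- `2 ^` (width of the position part) -/
  c1 : ℕ
  /-- `2 ^ e` -/
  c2 : ℕ
  /-- bit position of the table -/
  tb : ℕ

/-- An item of the list in the second label. -/
structure Item where
  -- `a` is the address of the chunk record, `M` the modulus that keeps the increments before the
  -- wanted block, `tgt` the position inside the block, `D` the own distance plus one, and `S` the
  -- total shift that keeps stored values nonnegative.
  a : ℕ
  M : ℕ
  tgt : ℕ
  D : ℕ
  S : ℕ

/-- The constants are where they belong. -/
structure Loaded (w : ℕ) (c : Consts) (s : State) : Prop where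
  r1 : s.reg 1 = w
  r2 : s.reg 2 = c.e
  r3 : s.reg 3 = c.c1
  r4 : s.reg 4 = c.c2
  r5 : s.reg 5 = c.tb

/-- Processing the item `it` on the first label reads the group starting at `p` with base value
`β`, and stops after `z` entries. -/
structure ItemSpec (w : ℕ) (x : List Bool) (c : Consts) (it : Item) (p β z : ℕ) : Prop where
  ha : it.a + 3 * w < 2 ^ w
  hX : c.tb + readWord w x (it.a + w) % it.M * w < 2 ^ w
  hX' : c.tb + readWord w x (it.a + 3 * w) % it.M * w < 2 ^ w
  hp : readWord w x it.a + readWord w x (c.tb + readWord w x (it.a + w) % it.M * w) = p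
  hβ : readWord w x (it.a + 2 * w) +
    readWord w x (c.tb + readWord w x (it.a + 3 * w) % it.M * w) = β
  hpz : p + z * c.e < 2 ^ w
  hval : β + c.c2 + it.D < 2 ^ w
  hlt : ∀ i < z, readWord w x (p + i * c.e) % c.c1 < it.tgt
  hz : it.tgt ≤ readWord w x (p + z * c.e) % c.c1

/-- The candidate value of an entry word. -/
def entryVal (c : Consts) (it : Item) (β ent : ℕ) : ℕ := β + ent % c.c2 / c.c1 + it.D - it.S

/-! ### Effect and running time of the pieces of the decoder -/

theorem exec_prefix {w : ℕ} {x y : List Bool} {c : Consts} {s : State} {a M b d : ℕ}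
    (hd : d = 14 ∨ d = 16)
    (hs : Loaded w c s) (h9 : s.reg 9 = a) (h10 : s.reg 10 = M) (ha : a + w < 2 ^ w)
    (hX : c.tb + readWord w x (a + w) % M * w < 2 ^ w)
    (hb : readWord w x a + readWord w x (c.tb + readWord w x (a + w) % M * w) = b)
    (hb' : b < 2 ^ w) :
    ∃ s', Exec w x y (block (prefixBlock d)) s 8 s' ∧ Loaded w c s' ∧ s'.reg d = b ∧
      s'.reg 9 = a + w ∧ ∀ r, r ≠ 9 → r ≠ 15 → r ≠ d → s'.reg r = s.reg r := by
  obtain ⟨h1, h2, h3, h4, h5⟩ := hs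
  have e1 : (a + w) % 2 ^ w = a + w := Nat.mod_eq_of_lt ha
  have e2 : readWord w x (a + w) % M * w % 2 ^ w = readWord w x (a + w) % M * w :=
    Nat.mod_eq_of_lt (by omega)
  have e3 : (readWord w x (a + w) % M * w + c.tb) % 2 ^ w =
    c.tb + readWord w x (a + w) % M * w := by
    rw [Nat.add_comm]; exact Nat.mod_eq_of_lt hX
  refine ⟨_, exec_block w x y (prefixBlock d) s, ?_, ?_, ?_, ?_⟩
  · rcases hd with rfl | rfl <;> constructor <;>
      simpa [prefixBlock, Instr.run, State.setReg]
  · rcases hd with rfl | rfl <;>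
    simp [prefixBlock, Instr.run, State.setReg, BinOp.eval, h1, h5, h9, h10, e1, e2, e3, hb,
      Nat.mod_eq_of_lt hb']
  · rcases hd with rfl | rfl <;>
    simp [prefixBlock, Instr.run, State.setReg, BinOp.eval, h1, h9, Nat.mod_eq_of_lt ha]
  · intro r h9 h15 h14
    simp [prefixBlock, Instr.run, State.setReg, h9, h14, h15]

theorem exec_item {w : ℕ} {x y : List Bool} {c : Consts} {s : State} {it : Item} {q : ℕ}
    (hs : Loaded w c s) (h6 : s.reg 6 = q) (hq : q + 5 * w < 2 ^ w)
    (r0 : readWord w y q = it.a) (r1 : readWord w y (q + w) = it.M)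
    (r2 : readWord w y (q + 2 * w) = it.tgt) (r3 : readWord w y (q + 3 * w) = it.D)
    (r4 : readWord w y (q + 4 * w) = it.S) :
    ∃ s', Exec w x y (block itemBlock) s 10 s' ∧ Loaded w c s' ∧ s'.reg 6 = q + 5 * w ∧
      s'.reg 9 = it.a ∧ s'.reg 10 = it.M ∧ s'.reg 11 = it.tgt ∧ s'.reg 12 = it.D ∧
      s'.reg 13 = it.S ∧ s'.reg 0 = s.reg 0 ∧ s'.reg 7 = s.reg 7 := by
  obtain ⟨h1, h2, h3, h4, h5⟩ := hs
  have e1 : (q + w) % 2 ^ w = q + w := Nat.mod_eq_of_lt (by omega)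
  have e2 : (q + w + w) % 2 ^ w = q + 2 * w := by rw [Nat.mod_eq_of_lt (by omega)]; ring
  have e3 : (q + 2 * w + w) % 2 ^ w = q + 3 * w := by rw [Nat.mod_eq_of_lt (by omega)]; ring
  have e4 : (q + 3 * w + w) % 2 ^ w = q + 4 * w := by rw [Nat.mod_eq_of_lt (by omega)]; ring
  have e5 : (q + 4 * w + w) % 2 ^ w = q + 5 * w := by rw [Nat.mod_eq_of_lt (by omega)]; ring
  refine ⟨_, exec_block w x y itemBlock s, ⟨?_, ?_, ?_, ?_, ?_⟩, ?_, ?_, ?_, ?_, ?_, ?_, ?_, ?_⟩ <;>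
  simp [itemBlock, Instr.run, State.setReg, BinOp.eval, h1, h2, h3, h4, h5, h6, e1, e2, e3, e4, e5,
    r0, r1, r2, r3, r4]

/-- Induction on the number `m` of entries still to be skipped. A round is one test and three
instructions; the final failing test is the extra step. -/
theorem exec_scan {w : ℕ} {x y : List Bool} {c : Consts} {tgt p z : ℕ}
    (hpz : p + z * c.e < 2 ^ w)
    (hlt : ∀ i < z, readWord w x (p + i * c.e) % c.c1 < tgt)
    (hz : tgt ≤ readWord w x (p + z * c.e) % c.c1)
    (m : ℕ) : ∀ (s : State) (i : ℕ), m + i = z → Loaded w c s → s.reg 14 = p + i * c.e →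
      s.reg 17 = readWord w x (p + i * c.e) → s.reg 18 = readWord w x (p + i * c.e) % c.c1 →
      s.reg 11 = tgt →
    ∃ s', Exec w x y scanLoop s (4 * m + 1) s' ∧ Loaded w c s' ∧
      s'.reg 17 = readWord w x (p + z * c.e) ∧ s'.reg 18 = readWord w x (p + z * c.e) % c.c1 ∧
      ∀ r, r ≠ 14 → r ≠ 17 → r ≠ 18 → s'.reg r = s.reg r := by
  induction m with
  | zero =>
    intro s i hi hs h14 h17 h18 h11
    obtain rfl : i = z := by omega
    refine ⟨s, .while_false ?_, hs, h17, h18, fun _ _ _ _ => rfl⟩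
    simp only [Test.Holds, h18, h11]
    omega
  | succ m ih =>
    intro s i hi hs h14 h17 h18 h11
    have hiz : i < z := by omega
    obtain ⟨h1, h2, h3, h4, h5⟩ := hs
    have hle : (i + 1) * c.e ≤ z * c.e := Nat.mul_le_mul_right _ (by omega)
    have e1 : (p + i * c.e + c.e) % 2 ^ w = p + (i + 1) * c.e := by
      rw [add_mul, one_mul] at *
      rw [Nat.mod_eq_of_lt (by omega)]; ring
    obtain ⟨s', hE, hL, a17, a18, ar⟩ := ih
      (stepBlock.foldl (fun s i => i.run w x y s) s) (i + 1) (by omega)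
      ⟨by simpa [stepBlock, Instr.run, State.setReg],
        by simpa [stepBlock, Instr.run, State.setReg],
        by simpa [stepBlock, Instr.run, State.setReg],
        by simpa [stepBlock, Instr.run, State.setReg],
        by simpa [stepBlock, Instr.run, State.setReg]⟩
      (by simp [stepBlock, Instr.run, State.setReg, BinOp.eval, h2, h14, e1])
      (by simp [stepBlock, Instr.run, State.setReg, BinOp.eval, h2, h14, e1])
      (by simp [stepBlock, Instr.run, State.setReg, BinOp.eval, h2, h3, h14, e1])
      (by simp [stepBlock, Instr.run, State.setReg, h11])
    refine ⟨s', ?_, hL, a17, a18, fun r n14 n17 n18 => ?_⟩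
    · have := Exec.while_true (w := w) (x := x) (y := y) (t := .lt 18 11) (s := s)
        (by simpa only [Test.Holds, h18, h11] using hlt i hiz)
        (exec_block w x y stepBlock s) hE
      have hk : stepBlock.length + 1 + (4 * m + 1) = 4 * (m + 1) + 1 := by
        simp [stepBlock]; ring
      rwa [hk] at this
    · rw [ar r n14 n17 n18]
      simp [stepBlock, Instr.run, State.setReg, n14, n17, n18]

theorem exec_update {w : ℕ} {x y : List Bool} {c : Consts} {s : State} {it : Item} {β ent : ℕ}
    (hs : Loaded w c s) (h11 : s.reg 11 = it.tgt) (h12 : s.reg 12 = it.D) (h13 : s.reg 13 = it.S)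
    (h16 : s.reg 16 = β) (h17 : s.reg 17 = ent) (h18 : s.reg 18 = ent % c.c1)
    (hc2 : 0 < c.c2) (hval : β + c.c2 + it.D < 2 ^ w)
    (hS : ent % c.c1 = it.tgt → it.S ≤ β + ent % c.c2 / c.c1 + it.D) :
    ∃ k s', k ≤ 8 ∧ Exec w x y updateProg s k s' ∧ Loaded w c s' ∧
      s'.reg 0 = (if ent % c.c1 = it.tgt then min (s.reg 0) (entryVal c it β ent) else s.reg 0) ∧
      s'.reg 6 = s.reg 6 ∧ s'.reg 7 = s.reg 7 := by
  obtain ⟨h1, h2, h3, h4, h5⟩ := hs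
  by_cases hh : ent % c.c1 = it.tgt
  · have hq : ent % c.c2 / c.c1 < c.c2 := (Nat.div_le_self _ _).trans_lt (Nat.mod_lt _ hc2)
    have hS := hS hh
    have e1 : (β + ent % c.c2 / c.c1) % 2 ^ w = β + ent % c.c2 / c.c1 :=
      Nat.mod_eq_of_lt (by omega)
    have e2 : (β + ent % c.c2 / c.c1 + it.D) % 2 ^ w = β + ent % c.c2 / c.c1 + it.D :=
      Nat.mod_eq_of_lt (by omega)
    -- Machine subtraction adds `2 ^ w - S` modulo `2 ^ w`; it is exact because `S` does not exceed
    -- the sum.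
    have e3 : (β + ent % c.c2 / c.c1 + it.D + (2 ^ w - it.S)) % 2 ^ w = entryVal c it β ent := by
      have : β + ent % c.c2 / c.c1 + it.D + (2 ^ w - it.S) = entryVal c it β ent + 2 ^ w := by
        unfold entryVal; omega
      rw [this, Nat.add_mod_right, Nat.mod_eq_of_lt]
      unfold entryVal; omega
    set s₁ := valueBlock.foldl (fun s i => i.run w x y s) s with hs₁
    have v16 : s₁.reg 16 = entryVal c it β ent := by
      simp [hs₁, valueBlock, Instr.run, State.setReg, BinOp.eval, h3, h4, h12, h13, h16, h17,
        e1, e2, e3]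
    have vr : ∀ r, r ≠ 16 → r ≠ 17 → s₁.reg r = s.reg r := by
      intro r n16 n17
      simp [hs₁, valueBlock, Instr.run, State.setReg, n16, n17]
    have hx := exec_block w x y valueBlock s
    rw [← hs₁] at hx
    by_cases hlt : s₁.reg 16 < s₁.reg 0
    · refine ⟨_, _, ?_, .ite_true (by simp only [Test.Holds, h18, h11, hh])
        (.seq hx (.ite_true hlt (exec_block w x y [.copy 0 16] s₁))), ⟨?_, ?_, ?_, ?_, ?_⟩, ?_, ?_, ?_⟩
      · simp [valueBlock]
      · simpa [Instr.run, State.setReg, vr]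
      · simpa [Instr.run, State.setReg, vr]
      · simpa [Instr.run, State.setReg, vr]
      · simpa [Instr.run, State.setReg, vr]
      · simpa [Instr.run, State.setReg, vr]
      · rw [v16, vr 0 (by decide) (by decide)] at hlt
        simp [Instr.run, State.setReg, v16, hh, hlt.le]
      · simp [Instr.run, State.setReg, vr]
      · simp [Instr.run, State.setReg, vr]
    · refine ⟨_, _, ?_, .ite_true (by simp only [Test.Holds, h18, h11, hh])
        (.seq hx (.ite_false hlt (.skip s₁))), ⟨?_, ?_, ?_, ?_, ?_⟩, ?_, ?_, ?_⟩
      · simp [valueBlock]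
      · simpa [vr]
      · simpa [vr]
      · simpa [vr]
      · simpa [vr]
      · simpa [vr]
      · rw [v16, vr 0 (by decide) (by decide)] at hlt
        rw [vr 0 (by decide) (by decide)]
        simp [hh, not_lt.1 hlt]
      · simp [vr]
      · simp [vr]
  · exact ⟨_, s, by omega, .ite_false (by simpa only [Test.Holds, h18, h11] using hh) (.skip s),
      ⟨h1, h2, h3, h4, h5⟩, by simp [hh], rfl, rfl⟩

/-- The pieces take 10, 8, 1, 8, 2, 4z + 1 and at most 8 steps. `hS` is conditional because the
difference is formed only on a match. -/
theorem exec_body {w : ℕ} {x y : List Bool} {c : Consts} {s : State} {it : Item} {q p β z : ℕ}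
    (hs : Loaded w c s) (h6 : s.reg 6 = q) (hq : q + 5 * w < 2 ^ w)
    (r0 : readWord w y q = it.a) (r1 : readWord w y (q + w) = it.M)
    (r2 : readWord w y (q + 2 * w) = it.tgt) (r3 : readWord w y (q + 3 * w) = it.D)
    (r4 : readWord w y (q + 4 * w) = it.S) (hc2 : 0 < c.c2)
    (hit : ItemSpec w x c it p β z)
    (hS : readWord w x (p + z * c.e) % c.c1 = it.tgt →
      it.S ≤ β + readWord w x (p + z * c.e) % c.c2 / c.c1 + it.D) :
    ∃ k s', k ≤ 40 + 4 * z ∧ Exec w x y bodyProg s k s' ∧ Loaded w c s' ∧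
      s'.reg 0 = (if readWord w x (p + z * c.e) % c.c1 = it.tgt then
        min (s.reg 0) (entryVal c it β (readWord w x (p + z * c.e))) else s.reg 0) ∧
      s'.reg 6 = q + 5 * w ∧ s'.reg 7 = s.reg 7 := by
  obtain ⟨s₁, x₁, l₁, a6, a9, a10, a11, a12, a13, a0, a7⟩ :=
    exec_item (x := x) hs h6 hq r0 r1 r2 r3 r4
  have hp := hit.hpz
  have hβ := hit.hval
  have ha := hit.ha
  obtain ⟨s₂, x₂, l₂, b14, b9, br⟩ := exec_prefix (y := y) (d := 14) (Or.inl rfl) l₁ a9 a10 (by omega)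
    hit.hX hit.hp (by omega)
  have e9 : (it.a + w + w) % 2 ^ w = it.a + 2 * w := by rw [Nat.mod_eq_of_lt (by omega)]; ring
  have x₃ := exec_block w x y [.op .add 9 9 1] s₂
  set s₃ := [Instr.op .add 9 9 1].foldl (fun s i => i.run w x y s) s₂ with hs₃
  have c9 : s₃.reg 9 = it.a + 2 * w := by
    simp [hs₃, Instr.run, State.setReg, BinOp.eval, b9, l₂.r1, e9]
  have cr : ∀ r, r ≠ 9 → s₃.reg r = s₂.reg r := by
    intro r n9
    simp [hs₃, Instr.run, State.setReg, n9]
  have l₃ : Loaded w c s₃ := ⟨by simp [cr, l₂.r1], by simp [cr, l₂.r2], by simp [cr, l₂.r3],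
    by simp [cr, l₂.r4], by simp [cr, l₂.r5]⟩
  have e3 : it.a + 2 * w + w = it.a + 3 * w := by ring
  obtain ⟨s₄, x₄, l₄, d16, d9, dr⟩ := exec_prefix (y := y) (d := 16) (Or.inr rfl) l₃ c9
    (M := it.M) (b := β) (by simp [cr, br, a10]) (by omega) (by rw [e3]; exact hit.hX')
    (by rw [e3]; exact hit.hβ) (by omega)
  have x₅ := exec_block w x y entryBlock s₄
  set s₅ := entryBlock.foldl (fun s i => i.run w x y s) s₄ with hs₅
  have d14 : s₄.reg 14 = p := by simp [dr, cr, b14]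
  have f17 : s₅.reg 17 = readWord w x p := by
    simp [hs₅, entryBlock, Instr.run, State.setReg, d14]
  have f18 : s₅.reg 18 = readWord w x p % c.c1 := by
    simp [hs₅, entryBlock, Instr.run, State.setReg, d14, BinOp.eval, l₄.r3]
  have fr : ∀ r, r ≠ 17 → r ≠ 18 → s₅.reg r = s₄.reg r := by
    intro r n17 n18
    simp [hs₅, entryBlock, Instr.run, State.setReg, n17, n18]
  have l₅ : Loaded w c s₅ := ⟨by simp [fr, l₄.r1], by simp [fr, l₄.r2], by simp [fr, l₄.r3],
    by simp [fr, l₄.r4], by simp [fr, l₄.r5]⟩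
  obtain ⟨s₆, x₆, l₆, g17, g18, gr⟩ := exec_scan (y := y) hit.hpz hit.hlt hit.hz z s₅ 0 (by omega) l₅
    (by simp [fr, d14]) (by simp [f17]) (by simp [f18])
    (by simp [fr, dr, cr, br, a11])
  obtain ⟨k, s₇, hk, x₇, l₇, i0, i6, i7⟩ := exec_update (x := x) (y := y) (it := it) (β := β) l₆
    (by simp [gr, fr, dr, cr, br, a11]) (by simp [gr, fr, dr, cr, br, a12])
    (by simp [gr, fr, dr, cr, br, a13]) (by simp [gr, fr, d16]) g17 g18 hc2
    hit.hval hS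
  refine ⟨_, s₇, ?_, .seq x₁ (.seq x₂ (.seq x₃ (.seq x₄ (.seq x₅ (.seq x₆ x₇))))), l₇, ?_, ?_, ?_⟩
  · simp [entryBlock]; omega
  · rw [i0]; simp [gr, fr, dr, cr, br, a0]
  · rw [i6]; simp [gr, fr, dr, cr, br, a6]
  · rw [i7]; simp [gr, fr, dr, cr, br, a7]

/-- The main loop computes a minimum of the candidate values. -/
theorem exec_loop {w : ℕ} {x y : List Bool} {c : Consts} {m b Z : ℕ} {it : ℕ → Item}
    {p β z : ℕ → ℕ} (hw : 0 < w) (hq : b + m * (5 * w) < 2 ^ w) (hc2 : 0 < c.c2)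
    (r0 : ∀ j < m, readWord w y (b + j * (5 * w)) = (it j).a)
    (r1 : ∀ j < m, readWord w y (b + j * (5 * w) + w) = (it j).M)
    (r2 : ∀ j < m, readWord w y (b + j * (5 * w) + 2 * w) = (it j).tgt)
    (r3 : ∀ j < m, readWord w y (b + j * (5 * w) + 3 * w) = (it j).D)
    (r4 : ∀ j < m, readWord w y (b + j * (5 * w) + 4 * w) = (it j).S)
    (hit : ∀ j < m, ItemSpec w x c (it j) (p j) (β j) (z j)) (hZ : ∀ j < m, z j ≤ Z)
    (hS : ∀ j < m, readWord w x (p j + z j * c.e) % c.c1 = (it j).tgt →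
      (it j).S ≤ β j + readWord w x (p j + z j * c.e) % c.c2 / c.c1 + (it j).D) (l : ℕ) :
    ∀ (s : State) (i : ℕ), l + i = m → Loaded w c s → s.reg 6 = b + i * (5 * w) →
      s.reg 7 = b + m * (5 * w) →
    ∃ k s', k ≤ l * (41 + 4 * Z) + 1 ∧ Exec w x y (.while (.lt 6 7) bodyProg) s k s' ∧
      s'.reg 0 ≤ s.reg 0 ∧
      (s'.reg 0 = s.reg 0 ∨ ∃ j < m, readWord w x (p j + z j * c.e) % c.c1 = (it j).tgt ∧
        s'.reg 0 = entryVal c (it j) (β j) (readWord w x (p j + z j * c.e))) ∧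
      ∀ j, i ≤ j → j < m → readWord w x (p j + z j * c.e) % c.c1 = (it j).tgt →
        s'.reg 0 ≤ entryVal c (it j) (β j) (readWord w x (p j + z j * c.e)) := by
  induction l with
  | zero =>
    intro s i hi hs h6 h7
    obtain rfl : i = m := by omega
    refine ⟨1, s, by omega, .while_false (by simp [Test.Holds, h6, h7]), le_rfl, Or.inl rfl,
      fun j h h' => by omega⟩
  | succ l ih =>
    intro s i hi hs h6 h7
    have him : i < m := by omega
    have hle : (i + 1) * (5 * w) ≤ m * (5 * w) := Nat.mul_le_mul_right _ (by omega)
    have he : (i + 1) * (5 * w) = i * (5 * w) + 5 * w := by ring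
    obtain ⟨k, s', hk, hx, hl, v0, v6, v7⟩ := exec_body hs h6 (by omega)
      (r0 i him) (r1 i him) (r2 i him) (r3 i him) (r4 i him) hc2 (hit i him) (hS i him)
    obtain ⟨k', s'', hk', hx', hle', hor, hmin⟩ := ih s' (i + 1) (by omega) hl
      (by rw [v6, he]; ring) (by rw [v7, h7])
    have hzi := hZ i him
    have h0 : s'.reg 0 ≤ s.reg 0 := by rw [v0]; split_ifs <;> simp
    refine ⟨_, s'', ?_, .while_true ?_ hx hx', hle'.trans h0, ?_, ?_⟩
    · rw [add_mul]; omega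
    · simp only [Test.Holds, h6, h7]; omega
    · rcases hor with h | h
      · rw [h, v0]
        split_ifs with hh
        · rcases min_choice (s.reg 0)
            (entryVal c (it i) (β i) (readWord w x (p i + z i * c.e))) with h' | h'
          · exact Or.inl h'
          · exact Or.inr ⟨i, him, hh, h'⟩
        · exact Or.inl rfl
      · exact Or.inr h
    · intro j hij hjm hh
      rcases hij.eq_or_lt with rfl | hij
      · refine hle'.trans ?_
        rw [v0, if_pos hh]
        exact min_le_right _ _
      · exact hmin j hij hjm hh

/-- What the decoder needs to find at the beginning of the labels. -/
structure Header (w : ℕ) (x : List Bool) (c : Consts) (comp inf b e : ℕ) : Prop where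
  h0 : readWord w x 0 = w
  h1 : readWord w x w = comp
  h2 : readWord w x (2 * w) = c.e
  h3 : readWord w x (3 * w) = c.c1
  h4 : readWord w x (4 * w) = c.c2
  h5 : readWord w x (5 * w) = c.tb
  h6 : readWord w x (6 * w) = inf
  h7 : readWord w x (7 * w) = b
  h8 : readWord w x (8 * w) = e

theorem exec_setup {w : ℕ} {x y : List Bool} {c c' : Consts} {k k' inf inf' b b' e e' : ℕ}
    (hw : 8 * w < 2 ^ w) (hx : Header w x c k inf b e) (hy : Header w y c' k' inf' b' e') :
    ∃ s, Exec w x y (block setupBlock) State.init 18 s ∧ Loaded w c s ∧ s.reg 0 = inf ∧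
      s.reg 6 = b' ∧ s.reg 7 = e' ∧ s.reg 19 = k ∧ s.reg 20 = k' := by
  have e2 : (w + w) % 2 ^ w = 2 * w := by rw [Nat.mod_eq_of_lt (by omega)]; ring
  have e3 : (2 * w + w) % 2 ^ w = 3 * w := by rw [Nat.mod_eq_of_lt (by omega)]; ring
  have e4 : (3 * w + w) % 2 ^ w = 4 * w := by rw [Nat.mod_eq_of_lt (by omega)]; ring
  have e5 : (4 * w + w) % 2 ^ w = 5 * w := by rw [Nat.mod_eq_of_lt (by omega)]; ring
  have e6 : (5 * w + w) % 2 ^ w = 6 * w := by rw [Nat.mod_eq_of_lt (by omega)]; ring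
  have e7 : (6 * w + w) % 2 ^ w = 7 * w := by rw [Nat.mod_eq_of_lt (by omega)]; ring
  have e8 : (7 * w + w) % 2 ^ w = 8 * w := by rw [Nat.mod_eq_of_lt (by omega)]; ring
  refine ⟨_, exec_block w x y setupBlock State.init, ⟨?_, ?_, ?_, ?_, ?_⟩, ?_, ?_, ?_, ?_, ?_⟩ <;>
  simp [setupBlock, Instr.run, State.setReg, State.init, BinOp.eval, e2, e3, e4, e5, e6, e7, e8,
    hx.h0, hx.h1, hx.h2, hx.h3, hx.h4, hx.h5, hx.h6, hy.h1, hy.h7, hy.h8]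

theorem exec_decoder_ne {w : ℕ} {x y : List Bool} {c c' : Consts} {k k' inf inf' b b' e e' : ℕ}
    (hw : 8 * w < 2 ^ w) (hx : Header w x c k inf b e) (hy : Header w y c' k' inf' b' e')
    (hk : k ≠ k') : OutputsWithin w decoder x y 20 ⊤ := by
  obtain ⟨s, hs, -, -, -, -, h19, h20⟩ := exec_setup hw hx hy
  refine ⟨_, _, ?_, .seq hs (.ite_false (by simpa [Test.Holds, h19, h20] using hk)
    (exec_block w x y _ s)), ?_⟩
  · simp
  · simp [State.output, Instr.run, State.setReg]

theorem exec_decoder_eq {w : ℕ} {x y : List Bool} {c c' : Consts} {k inf inf' b b' e m Z : ℕ}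
    {it : ℕ → Item} {p β z : ℕ → ℕ} (hw0 : 0 < w)
    (hw : 8 * w < 2 ^ w) (hx : Header w x c k inf b e)
    (hy : Header w y c' k inf' b' (b' + m * (5 * w)))
    (hq : b' + m * (5 * w) < 2 ^ w) (hc2 : 0 < c.c2)
    (r0 : ∀ j < m, readWord w y (b' + j * (5 * w)) = (it j).a)
    (r1 : ∀ j < m, readWord w y (b' + j * (5 * w) + w) = (it j).M)
    (r2 : ∀ j < m, readWord w y (b' + j * (5 * w) + 2 * w) = (it j).tgt)
    (r3 : ∀ j < m, readWord w y (b' + j * (5 * w) + 3 * w) = (it j).D)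
    (r4 : ∀ j < m, readWord w y (b' + j * (5 * w) + 4 * w) = (it j).S)
    (hit : ∀ j < m, ItemSpec w x c (it j) (p j) (β j) (z j)) (hZ : ∀ j < m, z j ≤ Z)
    (hS : ∀ j < m, readWord w x (p j + z j * c.e) % c.c1 = (it j).tgt →
      (it j).S ≤ β j + readWord w x (p j + z j * c.e) % c.c2 / c.c1 + (it j).D) :
    ∃ k s, k ≤ m * (41 + 4 * Z) + 20 ∧ Exec w x y decoder State.init k s ∧ s.reg 0 ≤ inf ∧
      (s.reg 0 = inf ∨ ∃ j < m, readWord w x (p j + z j * c.e) % c.c1 = (it j).tgt ∧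
        s.reg 0 = entryVal c (it j) (β j) (readWord w x (p j + z j * c.e))) ∧
      ∀ j < m, readWord w x (p j + z j * c.e) % c.c1 = (it j).tgt →
        s.reg 0 ≤ entryVal c (it j) (β j) (readWord w x (p j + z j * c.e)) := by
  obtain ⟨s, hs, hl, h0, h6, h7, h19, h20⟩ := exec_setup hw hx hy
  obtain ⟨k', s', hk', hx', hle, hor, hmin⟩ := exec_loop hw0 hq hc2 r0 r1 r2 r3 r4 hit hZ hS m s 0
    (by omega) hl (by simp [h6]) h7
  rw [h0] at hle hor
  exact ⟨_, s', by omega, .seq hs (.ite_true (by simp [Test.Holds, h19, h20]) hx'), hle, hor,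
    fun j hj => hmin j (Nat.zero_le _) hj⟩

end DistLabel

namespace DistLabel

open WordRAM

/-! ## Packing words into bit strings -/

theorem testBit_readWord (w : ℕ) (l : List Bool) (p i : ℕ) :
    (readWord w l p).testBit i = (decide (i < w) && l.getD (p + i) false) := by
  -- The bound is part of the induction: it ensures that adding `2 ^ w` produces no carry.
  have key : ∀ w, readWord w l p < 2 ^ w ∧
      ∀ i, (readWord w l p).testBit i = (decide (i < w) && l.getD (p + i) false) := by
    intro w
    induction w with
    | zero => simp [readWord]
    | succ w ih =>
      obtain ⟨hlt, hb⟩ := ih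
      have hs : readWord (w + 1) l p =
          readWord w l p + if l.getD (p + w) false then 2 ^ w else 0 := by
        simp [readWord, Finset.sum_range_succ]
      rw [hs]
      cases hl : l.getD (p + w) false with
      | false =>
        simp only [Bool.false_eq_true, if_false, add_zero]
        refine ⟨hlt.trans (Nat.pow_lt_pow_right (by omega) (by omega)), fun i => ?_⟩
        rw [hb]
        rcases lt_trichotomy i w with h | rfl | h
        · simp [h, h.trans (Nat.lt_succ_self w)]
        · rw [hl]; simp
        · have h1 : ¬ i < w := by omega
          have h2 : ¬ i < w + 1 := by omega
          simp [h1, h2]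
      | true =>
        simp only [if_true]
        refine ⟨by rw [pow_succ]; omega, fun i => ?_⟩
        rw [Nat.add_comm]
        rcases lt_trichotomy i w with h | rfl | h
        · rw [Nat.testBit_two_pow_add_gt h, hb]
          simp [h, h.trans (Nat.lt_succ_self w)]
        · rw [Nat.testBit_two_pow_add_eq, hb, hl]; simp
        · have h2 : ¬ i < w + 1 := by omega
          rw [Nat.testBit_lt_two_pow]
          · simp [h2]
          · calc 2 ^ w + readWord w l p < 2 ^ (w + 1) := by rw [pow_succ]; omega
              _ ≤ 2 ^ i := Nat.pow_le_pow_right (by omega) (by omega)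
  exact (key w).2 i

/-- A read always fetches `w` bits, so a narrow entry arrives with the bits that follow it; the
remainder removes them. -/
theorem readWord_mod_eq {w e : ℕ} {l : List Bool} {p a : ℕ} (he : e ≤ w) (ha : a < 2 ^ e)
    (h : ∀ i < e, l.getD (p + i) false = a.testBit i) : readWord w l p % 2 ^ e = a := by
  refine Nat.eq_of_testBit_eq fun i => ?_
  rw [Nat.testBit_mod_two_pow, testBit_readWord]
  by_cases hi : i < e
  · simp [hi, hi.trans_le he, ← h i hi]
  · rw [Nat.testBit_lt_two_pow (ha.trans_le (Nat.pow_le_pow_right (by omega) (not_lt.1 hi)))]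
    simp [hi]

theorem readWord_lt (w : ℕ) (l : List Bool) (p : ℕ) : readWord w l p < 2 ^ w := by
  refine Nat.lt_pow_two_of_testBit _ fun i hi => ?_
  rw [testBit_readWord]
  simp [not_lt.2 hi]

theorem readWord_eq {w : ℕ} {l : List Bool} {p a : ℕ} (ha : a < 2 ^ w)
    (h : ∀ i < w, l.getD (p + i) false = a.testBit i) : readWord w l p = a := by
  rw [← readWord_mod_eq le_rfl ha h, Nat.mod_eq_of_lt (readWord_lt _ _ _)]

/-- `nW` words of `w` bits followed by `nE` entries of `e` bits. -/
def packBits (w e nW nE : ℕ) (W E : ℕ → ℕ) : List Bool :=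
  (List.range (nW * w + nE * e)).map fun i =>
    if i < nW * w then (W (i / w)).testBit (i % w)
    else (E ((i - nW * w) / e)).testBit ((i - nW * w) % e)

theorem length_packBits (w e nW nE : ℕ) (W E : ℕ → ℕ) :
    (packBits w e nW nE W E).length = nW * w + nE * e := by simp [packBits]

theorem readWord_packBits_word {w e nW nE : ℕ} {W E : ℕ → ℕ} {i : ℕ} (hi : i < nW)
    (hW : W i < 2 ^ w) : readWord w (packBits w e nW nE W E) (i * w) = W i := by
  refine readWord_eq hW fun j hj => ?_
  have h1 : i * w + j < nW * w := by
    calc i * w + j < i * w + w := by omega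
      _ = (i + 1) * w := by ring
      _ ≤ nW * w := Nat.mul_le_mul_right _ hi
  have h2 : (i * w + j) / w = i := by
    rw [Nat.add_comm, Nat.add_mul_div_right _ _ (by omega), Nat.div_eq_of_lt hj, zero_add]
  have h3 : (i * w + j) % w = j := by
    rw [Nat.add_comm, Nat.add_mul_mod_self_right, Nat.mod_eq_of_lt hj]
  have h4 : i * w + j < nW * w + nE * e := by omega
  simp [packBits, List.getD_eq_getElem?_getD, h4, h1, h2, h3]

theorem readWord_packBits_entry {w e nW nE : ℕ} {W E : ℕ → ℕ} {i : ℕ} (hi : i < nE)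
    (he : e ≤ w) (hE : E i < 2 ^ e) :
    readWord w (packBits w e nW nE W E) (nW * w + i * e) % 2 ^ e = E i := by
  refine readWord_mod_eq he hE fun j hj => ?_
  have h1 : i * e + j < nE * e := by
    calc i * e + j < i * e + e := by omega
      _ = (i + 1) * e := by ring
      _ ≤ nE * e := Nat.mul_le_mul_right _ hi
  have h2 : (i * e + j) / e = i := by
    rw [Nat.add_comm, Nat.add_mul_div_right _ _ (by omega), Nat.div_eq_of_lt hj, zero_add]
  have h3 : (i * e + j) % e = j := by
    rw [Nat.add_comm, Nat.add_mul_mod_self_right, Nat.mod_eq_of_lt hj]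
  have h4 : nW * w + i * e + j < nW * w + nE * e := by omega
  have h5 : nW * w + i * e + j - nW * w = i * e + j := by omega
  have h6 : ¬ nW * w + i * e + j < nW * w := by omega
  simp [packBits, List.getD_eq_getElem?_getD, h4, h5, h6, h2, h3]

/-! ## Sampled prefix sums -/

/-- Sum of the `g` lowest digits of `X` in base `b`. -/
def digitSum (b g X : ℕ) : ℕ := ∑ j ∈ Finset.range g, X / b ^ j % b

/-- The number with base-`b` digits `a 0, …, a (g - 1)`. -/
def packDigits (b g : ℕ) (a : ℕ → ℕ) : ℕ := ∑ j ∈ Finset.range g, a j * b ^ j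

theorem packDigits_lt {b g : ℕ} {a : ℕ → ℕ} (ha : ∀ j, a j < b) : packDigits b g a < b ^ g := by
  induction g with
  | zero => simp [packDigits]
  | succ g ih =>
    rw [packDigits, Finset.sum_range_succ, ← packDigits]
    calc packDigits b g a + a g * b ^ g < b ^ g + a g * b ^ g := by omega
      _ = (a g + 1) * b ^ g := by ring
      _ ≤ b * b ^ g := Nat.mul_le_mul_right _ (ha g)
      _ = b ^ (g + 1) := by ring

theorem packDigits_add (b r l : ℕ) (a : ℕ → ℕ) :
    packDigits b (r + l) a = packDigits b r a + b ^ r * packDigits b l fun j => a (r + j) := by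
  simp only [packDigits, Finset.sum_range_add, Finset.mul_sum]
  congr 1
  exact Finset.sum_congr rfl fun j _ => by rw [pow_add]; ring

/-- This is how the decoder cuts a chunk down to the increments before a given block with one
operation. -/
theorem packDigits_mod {b g r : ℕ} {a : ℕ → ℕ} (ha : ∀ j, a j < b) (hr : r ≤ g) :
    packDigits b g a % b ^ r = packDigits b r a := by
  obtain ⟨l, rfl⟩ := Nat.exists_eq_add_of_le hr
  rw [packDigits_add, Nat.add_mul_mod_self_left, Nat.mod_eq_of_lt (packDigits_lt ha)]

theorem packDigits_div_mod {b g j : ℕ} {a : ℕ → ℕ} (ha : ∀ j, a j < b) (hj : j < g) :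
    packDigits b g a / b ^ j % b = a j := by
  have hb : 0 < b := (Nat.zero_le _).trans_lt (ha 0)
  obtain ⟨l, rfl⟩ := Nat.exists_eq_add_of_le (Nat.succ_le_of_lt hj)
  have h1 := packDigits_add b j (l + 1) a
  have h2 := packDigits_add b 1 l fun i => a (j + i)
  rw [show j + (l + 1) = j.succ + l by omega] at h1
  rw [Nat.add_comm 1 l] at h2
  rw [h1, Nat.add_mul_div_left _ _ (by positivity), Nat.div_eq_of_lt (packDigits_lt ha), zero_add, h2,
    pow_one, Nat.add_mul_mod_self_left]
  simp [packDigits, Nat.mod_eq_of_lt (ha j)]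

/-- The missing high digits are zero, so a single table summing all `g` digits serves prefixes of
every length. -/
theorem digitSum_packDigits {b g r : ℕ} {a : ℕ → ℕ} (ha : ∀ j, a j < b) (hr : r ≤ g) :
    digitSum b g (packDigits b r a) = ∑ j ∈ Finset.range r, a j := by
  obtain ⟨l, rfl⟩ := Nat.exists_eq_add_of_le hr
  have hb : 0 < b := (Nat.zero_le _).trans_lt (ha 0)
  rw [digitSum, Finset.sum_range_add, Finset.sum_congr rfl
    fun j hj => packDigits_div_mod ha (Finset.mem_range.1 hj)]
  conv_rhs => rw [← add_zero (∑ j ∈ Finset.range r, a j)]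
  congr 1
  refine Finset.sum_eq_zero fun j _ => ?_
  rw [Nat.div_eq_of_lt ((packDigits_lt ha).trans_le (Nat.pow_le_pow_right hb (by omega))),
    Nat.zero_mod]

/-- Guarantees that the table entries fit into words. -/
theorem digitSum_le {b : ℕ} (hb : 0 < b) (g X : ℕ) : digitSum b g X ≤ X := by
  have h : ∀ g, ∑ j ∈ Finset.range g, X / b ^ j % b * b ^ j = X % b ^ g := by
    intro g
    induction g with
    | zero => simp [Nat.mod_one]
    | succ g ih => rw [Finset.sum_range_succ, ih, pow_succ, Nat.mod_mul]; ring
  calc digitSum b g X ≤ ∑ j ∈ Finset.range g, X / b ^ j % b * b ^ j :=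
        Finset.sum_le_sum fun j _ => Nat.le_mul_of_pos_right _ (by positivity)
    _ = X % b ^ g := h g
    _ ≤ X := Nat.mod_le _ _

/-- The packed increments of the sequence `a` in its `q`-th chunk of length `g`. -/
def chunk (b g : ℕ) (a : ℕ → ℕ) (q : ℕ) : ℕ := packDigits b g fun j => a (q * g + j + 1) - a (q * g + j)

/-- The increments kept by the remainder telescope. Monotonicity makes the truncated subtraction
exact, and the step bound makes each increment a single digit. -/
theorem sampled_add_digitSum {b g : ℕ} (hg : 0 < g) {a : ℕ → ℕ} (hmono : ∀ k, a k ≤ a (k + 1))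
    (hstep : ∀ k, a (k + 1) < a k + b) (k : ℕ) :
    a (k / g * g) + digitSum b g (chunk b g a (k / g) % b ^ (k % g)) = a k := by
  have hd : ∀ j, a (k / g * g + j + 1) - a (k / g * g + j) < b := fun j => by
    have := hstep (k / g * g + j); have := hmono (k / g * g + j); omega
  have hr : k % g ≤ g := (Nat.mod_lt _ hg).le
  rw [chunk, packDigits_mod hd hr, digitSum_packDigits hd hr]
  have : ∀ r, a (k / g * g) + ∑ j ∈ Finset.range r, (a (k / g * g + j + 1) - a (k / g * g + j)) =
      a (k / g * g + r) := by
    intro r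
    induction r with
    | zero => simp
    | succ r ih =>
      rw [Finset.sum_range_succ, ← add_assoc, ih]
      have := hmono (k / g * g + r)
      rw [← add_assoc]
      omega
  rw [this, Nat.div_add_mod']

theorem chunk_lt {b g : ℕ} {a : ℕ → ℕ} (hmono : ∀ k, a k ≤ a (k + 1))
    (hstep : ∀ k, a (k + 1) < a k + b) (q : ℕ) : chunk b g a q < b ^ g :=
  packDigits_lt fun j => by have := hstep (q * g + j); have := hmono (q * g + j); omega

end DistLabel

namespace DistLabel

open WordRAM

/-! ## Layout of the labels -/

/-- Parameters of the layout. -/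
structure Params where
  /-- word size -/
  w : ℕ
  /-- logarithm of the block length -/
  lam : ℕ
  /-- number of fields per chunk -/
  g : ℕ
  /-- number of blocks -/
  N : ℕ
  /-- bound on the distances -/
  K : ℕ

namespace Params

variable (p : Params)

/-- Block length. -/
def B : ℕ := 2 ^ p.lam

/-- Width of an entry. -/
def e : ℕ := 2 * p.lam + 4

/-- Number of words of the table. -/
def tab : ℕ := 2 ^ (p.e * p.g)

/-- Number of chunks. -/
def NC : ℕ := p.N / p.g + 1

/-- Number of words before the list of items. -/
def listStart : ℕ := 9 + p.tab + 4 * p.NC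

def consts : Consts := ⟨p.e, 2 ^ (p.lam + 2), 2 ^ p.e, 9 * p.w⟩

/-- A block has at most B hubs and one end marker, so the increments of `ptr` are digits in base `2
^ e`. -/
theorem e_mul_lt : p.e * (p.B + 1) < 2 ^ p.e := by
  have h1 : p.lam + 2 ≤ 2 ^ (p.lam + 1) := Nat.lt_two_pow_self
  have h2 : 1 ≤ 2 ^ p.lam := Nat.one_le_two_pow
  have h3 : 0 < 2 ^ (2 * p.lam) := by positivity
  unfold e B
  calc (2 * p.lam + 4) * (2 ^ p.lam + 1) ≤ (2 * 2 ^ (p.lam + 1)) * (2 * 2 ^ p.lam) := by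
        gcongr <;> omega
    _ = 8 * 2 ^ (2 * p.lam) := by rw [two_mul p.lam, pow_add, pow_add]; ring
    _ < 16 * 2 ^ (2 * p.lam) := by omega
    _ = 2 ^ (2 * p.lam + 4) := by rw [pow_add]; ring

/-- The same for the increments of `base`, which are at most 2B. -/
theorem two_B_lt : 2 * p.B < 2 ^ p.e := by
  unfold e B
  calc 2 * 2 ^ p.lam = 2 ^ (p.lam + 1) := by ring
    _ < _ := Nat.pow_lt_pow_right (by omega) (by omega)

end Params

/-- The contents of a label: component identifier, distances to the positions of the tour, the
positions of the hubs, and the list of own hubs (position and distance). -/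
structure Content where
  comp : ℕ
  η : ℕ → ℕ
  P : Finset ℕ
  items : List (ℕ × ℕ)

namespace Content

variable (d : Content) (p : Params)

/-- Relative positions of the hubs in block `k`. -/
def blockPos (k : ℕ) : List ℕ := (List.range p.B).filter fun j => k * p.B + j ∈ d.P

/-- The entry of the hub with relative position `j` in block `k`. -/
def entry (k j : ℕ) : ℕ :=
  j + 2 ^ (p.lam + 2) * (d.η (k * p.B + j) + p.B - d.η (k * p.B))

/-- The entries of block `k` with an end marker. -/
def group (k : ℕ) : List ℕ := (d.blockPos p k).map (d.entry p k) ++ [p.B]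

/-- Number of entries before block `k`. -/
def start (k : ℕ) : ℕ := ∑ j ∈ Finset.range k, (d.group p j).length

/-- All entries. -/
def entries : List ℕ := (List.range p.N).flatMap (d.group p)

/-- Number of words. -/
def nW : ℕ := p.listStart + 5 * d.items.length

/-- Bit position of the entries of block `k`. -/
def ptr (k : ℕ) : ℕ := d.nW p * p.w + p.e * d.start p k

/-- Distance to the first position of block `k`, plus `k` times the block length. -/
def base (k : ℕ) : ℕ := d.η (k * p.B) + p.B * k

/-- The header. -/
def header : List ℕ :=
  [p.w, d.comp, p.e, 2 ^ (p.lam + 2), 2 ^ p.e, 9 * p.w, 2 * p.K + 2, p.listStart * p.w,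
    p.listStart * p.w + d.items.length * (5 * p.w)]

/-- Words of the `q`-th chunk record. -/
def record (q : ℕ) : List ℕ :=
  [d.ptr p (q * p.g), chunk (2 ^ p.e) p.g (d.ptr p) q,
    d.base p (q * p.g), chunk (2 ^ p.e) p.g (d.base p) q]

/-- Item for the position `t` at distance `δ`. -/
def _root_.DistLabel.mkItem (p : Params) (t δ : ℕ) : Item :=
  let k := t / p.B
  ⟨(9 + p.tab + 4 * (k / p.g)) * p.w, (2 ^ p.e) ^ (k % p.g), t % p.B, δ + 1, p.B * (k + 1)⟩

/-- Words of the `j`-th item. -/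
def itemWords (j : ℕ) : List ℕ :=
  let it := mkItem p (d.items.getD j (0, 0)).1 (d.items.getD j (0, 0)).2
  [it.a, it.M, it.tgt, it.D, it.S]

/-- The `i`-th word of the label. -/
def word (i : ℕ) : ℕ :=
  if i < 9 then (d.header p).getD i 0
  else if i < 9 + p.tab then digitSum (2 ^ p.e) p.g (i - 9)
  else if i < p.listStart then
    (d.record p ((i - (9 + p.tab)) / 4)).getD ((i - (9 + p.tab)) % 4) 0
  else (d.itemWords p ((i - p.listStart) / 5)).getD ((i - p.listStart) % 5) 0

/-- The label. -/
def label : List Bool :=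
  packBits p.w p.e (d.nW p) (d.entries p).length (d.word p) fun i => (d.entries p).getD i 0

/-- Conditions under which the label can be decoded. -/
structure Valid : Prop where
  hg : 0 < p.g
  hgw : p.e * p.g ≤ p.w
  hlip : ∀ i, d.η (i + 1) ≤ d.η i + 1 ∧ d.η i ≤ d.η (i + 1) + 1
  hη : ∀ i, d.η i ≤ p.K
  hlen : d.nW p * p.w + (d.entries p).length * p.e < 2 ^ p.w
  hcomp : d.comp < 2 ^ p.w
  -- Prevents overflow in the evaluation of an item and in the initial value of the minimum.
  hcap : p.B * (p.N + 1) + 2 ^ p.e + 2 * p.K + 5 < 2 ^ p.w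
  hitems : ∀ i ∈ d.items, i.1 < p.N * p.B ∧ i.2 ≤ p.K

variable {d p}

theorem length_blockPos_le (k : ℕ) : (d.blockPos p k).length ≤ p.B := by
  simpa [blockPos] using List.length_filter_le (fun j => decide (k * p.B + j ∈ d.P)) (List.range p.B)

theorem length_group (k : ℕ) : (d.group p k).length = (d.blockPos p k).length + 1 := by
  simp [group]

theorem length_entries : (d.entries p).length = d.start p p.N := by
  have : ∀ N, ((List.range N).flatMap (d.group p)).length = d.start p N := by
    intro N
    induction N with
    | zero => simp [start]
    | succ N ih =>
      rw [List.range_succ, List.flatMap_append, List.length_append, ih]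
      simp [start, Finset.sum_range_succ]
  exact this _

/-- The hubs of block k are the positions t in `P` with t / B = k, and these sets are disjoint. -/
theorem sum_length_blockPos_le (N : ℕ) :
    ∑ k ∈ Finset.range N, (d.blockPos p k).length ≤ d.P.card := by
  have hB : 0 < p.B := by unfold Params.B; positivity
  have h : ∀ k, (d.blockPos p k).length = (d.P.filter fun t => t / p.B = k).card := by
    intro k
    have hnd : (d.blockPos p k).Nodup := List.Nodup.filter _ List.nodup_range
    rw [← List.toFinset_card_of_nodup hnd]
    refine Finset.card_bij (fun j _ => k * p.B + j) ?_ ?_ ?_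
    · intro j hj
      simp only [blockPos, List.mem_toFinset, List.mem_filter, List.mem_range,
        decide_eq_true_eq] at hj
      simp only [Finset.mem_filter]
      refine ⟨hj.2, ?_⟩
      rw [Nat.add_comm, Nat.add_mul_div_right _ _ hB, Nat.div_eq_of_lt hj.1, zero_add]
    · intro a _ b _ hab; omega
    · intro t ht
      simp only [Finset.mem_filter] at ht
      have hd : k * p.B + t % p.B = t := by rw [← ht.2]; exact Nat.div_add_mod' _ _
      refine ⟨t % p.B, ?_, hd⟩
      simp only [blockPos, List.mem_toFinset, List.mem_filter, List.mem_range,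
        decide_eq_true_eq]
      exact ⟨Nat.mod_lt _ hB, by rw [hd]; exact ht.1⟩
  simp only [h]
  rw [← Finset.card_biUnion]
  · refine Finset.card_le_card fun t ht => ?_
    simp only [Finset.mem_biUnion, Finset.mem_filter] at ht
    obtain ⟨_, _, h, _⟩ := ht
    exact h
  · intro a _ b _ hab
    rw [Function.onFun, Finset.disjoint_left]
    intro t h1 h2
    simp only [Finset.mem_filter] at h1 h2
    exact hab (h1.2.symm.trans h2.2)

theorem length_entries_le : (d.entries p).length ≤ d.P.card + p.N := by
  rw [length_entries, start]
  simp only [length_group, Finset.sum_add_distrib, Finset.sum_const, Finset.card_range, smul_eq_mul,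
    mul_one]
  have := sum_length_blockPos_le (d := d) (p := p) p.N
  omega

theorem length_label : (d.label p).length = d.nW p * p.w + (d.entries p).length * p.e :=
  length_packBits _ _ _ _ _ _

theorem getD_entries {k i : ℕ} (hk : k < p.N) (hi : i < (d.group p k).length) :
    (d.entries p).getD (d.start p k + i) 0 = (d.group p k).getD i 0 := by
  have key : ∀ N, k < N →
      ((List.range N).flatMap (d.group p)).getD (d.start p k + i) 0 = (d.group p k).getD i 0 := by
    intro N
    induction N with
    | zero => omega
    | succ N ih =>
      intro hkN
      -- The groups do not depend on the number of blocks, so the length formula applies with that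
      -- parameter replaced.
      have hlen' : ((List.range N).flatMap (d.group p)).length = d.start p N :=
        length_entries (d := d) (p := { p with N := N })
      rw [List.range_succ, List.flatMap_append]
      rcases (Nat.lt_succ_iff.1 hkN).eq_or_lt with rfl | h
      · rw [List.getD_append_right _ _ _ _ (by omega), hlen']
        simp
      · rw [List.getD_append _ _ _ _, ih h]
        rw [hlen']
        calc d.start p k + i < d.start p (k + 1) := by
              rw [start, start, Finset.sum_range_succ]; omega
          _ ≤ d.start p N := Finset.sum_le_sum_of_subset (Finset.range_subset_range.2 h)
  exact key p.N hk

theorem start_mono {k l : ℕ} (h : k ≤ l) : d.start p k ≤ d.start p l :=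
  Finset.sum_le_sum_of_subset (Finset.range_subset_range.2 h)

theorem start_succ (k : ℕ) : d.start p (k + 1) = d.start p k + (d.group p k).length :=
  Finset.sum_range_succ _ _

theorem ptr_mono (k : ℕ) : d.ptr p k ≤ d.ptr p (k + 1) := by
  unfold ptr
  gcongr
  exact start_mono (Nat.le_succ k)

theorem ptr_step (k : ℕ) : d.ptr p (k + 1) < d.ptr p k + 2 ^ p.e := by
  have h1 : p.e * (d.group p k).length ≤ p.e * (p.B + 1) :=
    Nat.mul_le_mul_left _ (by rw [length_group]; have := length_blockPos_le (d := d) (p := p) k; omega)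
  have h2 := p.e_mul_lt
  simp only [ptr, start_succ, mul_add]
  omega

theorem Valid.lip_add (h : d.Valid p) (i j : ℕ) :
    d.η (i + j) ≤ d.η i + j ∧ d.η i ≤ d.η (i + j) + j := by
  induction j with
  | zero => simp
  | succ j ih =>
    have := h.hlip (i + j)
    rw [← add_assoc]
    omega

/-- The distance can drop by at most B across a block; the summand `p.B * k` in `base` compensates
for it. -/
theorem Valid.base_mono (h : d.Valid p) (k : ℕ) : d.base p k ≤ d.base p (k + 1) := by
  have := (h.lip_add (k * p.B) p.B).2
  simp only [base, add_mul, mul_add, one_mul, mul_one]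
  omega

theorem Valid.base_step (h : d.Valid p) (k : ℕ) : d.base p (k + 1) < d.base p k + 2 ^ p.e := by
  have := (h.lip_add (k * p.B) p.B).1
  have := p.two_B_lt
  simp only [base, add_mul, mul_add, one_mul, mul_one]
  omega

theorem B_pos : 0 < p.B := by unfold Params.B; positivity

theorem Valid.mul_w_le (_ : d.Valid p) {i : ℕ} (hi : i ≤ d.nW p) : i * p.w ≤ d.nW p * p.w :=
  Nat.mul_le_mul_right _ hi

theorem Valid.w_pos (h : d.Valid p) : 0 < p.w :=
  (Nat.mul_pos (show 0 < p.e by unfold Params.e; omega) h.hg).trans_le h.hgw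

theorem Valid.read_word (_ : d.Valid p) {i v : ℕ} (hi : i < d.nW p) (hw : d.word p i = v)
    (hv : v < 2 ^ p.w) : readWord p.w (d.label p) (i * p.w) = v := by
  rw [← hw] at hv ⊢
  exact readWord_packBits_word hi hv

theorem Valid.nine_le (_ : d.Valid p) : 9 ≤ d.nW p := by
  unfold nW Params.listStart; omega

theorem Valid.header_ok (h : d.Valid p) :
    Header p.w (d.label p) p.consts d.comp (2 * p.K + 2) (p.listStart * p.w)
      (p.listStart * p.w + d.items.length * (5 * p.w)) := by
  have h9 := h.nine_le
  have hlen := h.hlen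
  have hcap := h.hcap
  have hm := h.mul_w_le h9
  have hw := h.w_pos
  have he : p.e * 1 ≤ p.e * p.g := Nat.mul_le_mul_left _ h.hg
  have hew := h.hgw
  have hw2 : p.w < 2 ^ p.w := Nat.lt_two_pow_self
  have hc : 2 ^ (p.lam + 2) ≤ 2 ^ p.e :=
    Nat.pow_le_pow_right (by omega) (by unfold Params.e; omega)
  have hls : p.listStart * p.w + d.items.length * (5 * p.w) = d.nW p * p.w := by
    unfold nW; ring
  have hinf : 2 * p.K + 2 < 2 ^ p.w :=
    lt_of_lt_of_le (by omega : 2 * p.K + 2 < 2 * p.K + 5) ((Nat.le_add_left _ _).trans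
      (show p.B * (p.N + 1) + 2 ^ p.e + (2 * p.K + 5) ≤ 2 ^ p.w by rw [← add_assoc]; exact hcap.le))
  have hw0 : ∀ i < 9, d.word p i = (d.header p).getD i 0 := fun i hi => by simp [word, hi]
  constructor
  · simpa using h.read_word (i := 0) (by omega) (by rw [hw0 _ (by omega)]; rfl) hw2
  · simpa using h.read_word (i := 1) (by omega) (by rw [hw0 _ (by omega)]; rfl) h.hcomp
  · exact h.read_word (i := 2) (by omega) (by rw [hw0 _ (by omega)]; rfl)
      (show p.e < 2 ^ p.w by omega)
  · exact h.read_word (i := 3) (by omega) (by rw [hw0 _ (by omega)]; rfl)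
      (show 2 ^ (p.lam + 2) < 2 ^ p.w by omega)
  · exact h.read_word (i := 4) (by omega) (by rw [hw0 _ (by omega)]; rfl)
      (show 2 ^ p.e < 2 ^ p.w by omega)
  · exact h.read_word (i := 5) (by omega) (by rw [hw0 _ (by omega)]; rfl)
      (show 9 * p.w < 2 ^ p.w by omega)
  · exact h.read_word (i := 6) (by omega) (by rw [hw0 _ (by omega)]; rfl) hinf
  · exact h.read_word (i := 7) (by omega) (by rw [hw0 _ (by omega)]; rfl) (by omega)
  · exact h.read_word (i := 8) (by omega) (by rw [hw0 _ (by omega)]; rfl) (by omega)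

theorem Valid.read_table (h : d.Valid p) {X : ℕ} (hX : X < p.tab) :
    9 * p.w + X * p.w < 2 ^ p.w ∧
    readWord p.w (d.label p) (9 * p.w + X * p.w) = digitSum (2 ^ p.e) p.g X := by
  have hn : 9 + X < d.nW p := by unfold nW Params.listStart; omega
  have hlen := h.hlen
  have hm := h.mul_w_le hn.le
  have hX' : X ≤ (9 + X) * p.w := by have := h.w_pos; nlinarith
  rw [← add_mul]
  refine ⟨by omega, h.read_word hn ?_ ?_⟩
  · have : ¬ 9 + X < 9 := by omega
    simp [word, hX]
  · exact (digitSum_le (by positivity) _ _).trans_lt (by omega)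

theorem Valid.read_record (h : d.Valid p) {q i v : ℕ} (hq : q < p.NC) (hi : i < 4)
    (hv : (d.record p q).getD i 0 = v) (hlt : v < 2 ^ p.w) :
    readWord p.w (d.label p) ((9 + p.tab + 4 * q) * p.w + i * p.w) = v := by
  rw [← add_mul]
  refine h.read_word ?_ ?_ hlt
  · unfold nW Params.listStart; omega
  · have h1 : ¬ 9 + p.tab + 4 * q + i < 9 := by omega
    have h2 : ¬ 9 + p.tab + 4 * q + i < 9 + p.tab := by omega
    have h3 : 9 + p.tab + 4 * q + i < p.listStart := by unfold Params.listStart; omega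
    have h4 : 9 + p.tab + 4 * q + i - (9 + p.tab) = 4 * q + i := by omega
    have h5 : (4 * q + i) / 4 = q := by omega
    have h6 : (4 * q + i) % 4 = i := by omega
    rw [word, if_neg h1, if_neg h2, if_pos h3, h4, h5, h6, hv]

theorem Valid.read_itemWord (h : d.Valid p) {j i v : ℕ} (hj : j < d.items.length) (hi : i < 5)
    (hv : (d.itemWords p j).getD i 0 = v) (hlt : v < 2 ^ p.w) :
    readWord p.w (d.label p) (p.listStart * p.w + j * (5 * p.w) + i * p.w) = v := by
  have : p.listStart * p.w + j * (5 * p.w) + i * p.w = (p.listStart + 5 * j + i) * p.w := by ring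
  rw [this]
  refine h.read_word (by unfold nW; omega) ?_ hlt
  have h0 : 9 + p.tab ≤ p.listStart := by unfold Params.listStart; omega
  have h1 : ¬ p.listStart + 5 * j + i < 9 := by omega
  have h2 : ¬ p.listStart + 5 * j + i < 9 + p.tab := by omega
  have h3 : ¬ p.listStart + 5 * j + i < p.listStart := by omega
  have h4 : p.listStart + 5 * j + i - p.listStart = 5 * j + i := by omega
  have h5 : (5 * j + i) / 5 = j := by omega
  have h6 : (5 * j + i) % 5 = i := by omega
  rw [word, if_neg h1, if_neg h2, if_neg h3, h4, h5, h6, hv]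

end Content

end DistLabel

/-! ### Correctness of the decoder on valid labels -/

namespace DistLabel

open WordRAM

namespace Content

variable {d : Content} {p : Params}

theorem mem_blockPos {k j : ℕ} : j ∈ d.blockPos p k ↔ j < p.B ∧ k * p.B + j ∈ d.P := by
  simp [blockPos]

theorem Valid.diff_le (h : d.Valid p) {k j : ℕ} (hj : j < p.B) :
    d.η (k * p.B + j) + p.B - d.η (k * p.B) ≤ 2 * p.B := by
  have := (h.lip_add (k * p.B) j).1
  omega

theorem two_pow_lam : 2 ^ (p.lam + 2) = 4 * p.B := by unfold Params.B; ring

theorem two_pow_e : 2 ^ p.e = 4 * p.B * (4 * p.B) := by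
  unfold Params.B Params.e; rw [show 2 * p.lam + 4 = (p.lam + 2) + (p.lam + 2) by ring, pow_add]; ring

/-- The position is below B and the shifted difference at most 2B; both are below 4B = `2 ^ (lam +
2)`, hence each fits into half of the entry. -/
theorem Valid.entry_lt (h : d.Valid p) {k j : ℕ} (hj : j < p.B) : d.entry p k j < 2 ^ p.e := by
  have := h.diff_le (k := k) hj
  rw [entry, two_pow_lam, two_pow_e]
  nlinarith

theorem entry_mod {k j : ℕ} (hj : j < p.B) : d.entry p k j % 2 ^ (p.lam + 2) = j := by
  rw [entry, Nat.add_mul_mod_self_left, Nat.mod_eq_of_lt]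
  rw [two_pow_lam]; omega

theorem entry_div {k j : ℕ} (hj : j < p.B) :
    d.entry p k j / 2 ^ (p.lam + 2) = d.η (k * p.B + j) + p.B - d.η (k * p.B) := by
  rw [entry, Nat.add_mul_div_left _ _ (by positivity), Nat.div_eq_of_lt, zero_add]
  rw [two_pow_lam]; omega

theorem Valid.group_lt (h : d.Valid p) {k a : ℕ} (ha : a ∈ d.group p k) : a < 2 ^ p.e := by
  simp only [group, List.mem_append, List.mem_map, List.mem_singleton] at ha
  rcases ha with ⟨j, hj, rfl⟩ | rfl
  · exact h.entry_lt (mem_blockPos.1 hj).1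
  · have := p.two_B_lt; omega

theorem e_le_w (h : d.Valid p) : p.e ≤ p.w :=
  (Nat.le_mul_of_pos_right _ h.hg).trans h.hgw

theorem start_add_le {k i : ℕ} (hk : k < p.N) (hi : i < (d.group p k).length) :
    d.start p k + i < (d.entries p).length := by
  rw [length_entries]
  calc d.start p k + i < d.start p (k + 1) := by rw [start_succ]; omega
    _ ≤ _ := start_mono hk

theorem Valid.read_entry (h : d.Valid p) {k i : ℕ} (hk : k < p.N) (hi : i < (d.group p k).length) :
    readWord p.w (d.label p) (d.ptr p k + i * p.e) % 2 ^ p.e = (d.group p k)[i] := by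
  have h1 : d.ptr p k + i * p.e = d.nW p * p.w + (d.start p k + i) * p.e := by unfold ptr; ring
  have h2 : (d.entries p).getD (d.start p k + i) 0 = (d.group p k)[i] := by
    rw [getD_entries hk hi, List.getD_eq_getElem _ _ hi]
  rw [h1, label, readWord_packBits_entry (start_add_le hk hi) (e_le_w h), h2]
  rw [h2]
  exact h.group_lt (List.getElem_mem hi)

theorem Valid.read_entry_mod (h : d.Valid p) {k i : ℕ} (hk : k < p.N)
    (hi : i < (d.group p k).length) :
    readWord p.w (d.label p) (d.ptr p k + i * p.e) % 2 ^ (p.lam + 2) =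
      (d.group p k)[i] % 2 ^ (p.lam + 2) := by
  rw [← h.read_entry hk hi, Nat.mod_mod_of_dvd]
  exact pow_dvd_pow 2 (by unfold Params.e; omega)

/-- The relative positions with an end marker. -/
theorem group_mod {k i : ℕ} (hi : i < (d.group p k).length) :
    (d.group p k)[i] % 2 ^ (p.lam + 2) = (d.blockPos p k).getD i p.B := by
  have hl := length_group (d := d) (p := p) k
  by_cases h : i < (d.blockPos p k).length
  · have : (d.group p k)[i] = d.entry p k (d.blockPos p k)[i] := by
      simp [group, h]
    rw [this, List.getD_eq_getElem _ _ h, entry_mod (mem_blockPos.1 (List.getElem_mem h)).1]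
  · have : (d.group p k)[i] = p.B := by
      simp [group, List.getElem_append, h]
    rw [this, List.getD_eq_default _ _ (not_lt.1 h), Nat.mod_eq_of_lt]
    rw [two_pow_lam]; have := B_pos (p := p); omega

theorem Valid.ptr_add_le (h : d.Valid p) {k i : ℕ} (hk : k < p.N)
    (hi : i < (d.group p k).length) : d.ptr p k + i * p.e < 2 ^ p.w := by
  have h1 : d.ptr p k + i * p.e = d.nW p * p.w + (d.start p k + i) * p.e := by unfold ptr; ring
  have h2 : (d.start p k + i) * p.e ≤ (d.entries p).length * p.e :=
    Nat.mul_le_mul_right _ (start_add_le hk hi).le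
  have := h.hlen
  omega

/-- The positions in a group increase and end with the marker B, which exceeds every target. The
scan therefore stops at the first position not below the target, and this is the target exactly if
`t` is stored. The base contributes η(kB) + Bk, the entry η(t) + B - η(kB), and `D` is δ + 1;
subtracting B(k + 1) leaves η(t) + δ + 1. -/
theorem Valid.item_spec (h : d.Valid p) {t δ : ℕ} (ht : t < p.N * p.B) (hδ : δ ≤ p.K) :
    ∃ z ≤ p.B, ItemSpec p.w (d.label p) p.consts (mkItem p t δ) (d.ptr p (t / p.B))
        (d.base p (t / p.B)) z ∧
      (readWord p.w (d.label p) (d.ptr p (t / p.B) + z * p.e) % 2 ^ (p.lam + 2) = t % p.B ↔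
        t ∈ d.P) ∧
      (t ∈ d.P → (mkItem p t δ).S ≤ d.base p (t / p.B) +
          readWord p.w (d.label p) (d.ptr p (t / p.B) + z * p.e) % 2 ^ p.e / 2 ^ (p.lam + 2) +
          (mkItem p t δ).D ∧
        entryVal p.consts (mkItem p t δ) (d.base p (t / p.B))
          (readWord p.w (d.label p) (d.ptr p (t / p.B) + z * p.e)) = d.η t + δ + 1) := by
  classical
  have hB : 0 < p.B := B_pos
  set k := t / p.B with hkdef
  have hk : k < p.N := (Nat.div_lt_iff_lt_mul hB).2 ht
  have htk : k * p.B + t % p.B = t := Nat.div_add_mod' _ _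
  have hr : t % p.B < p.B := Nat.mod_lt _ hB
  have hl := length_group (d := d) (p := p) k
  set bp := d.blockPos p k with hbp
  have hlB : bp.length ≤ p.B := length_blockPos_le k
  -- The default value `p.B` of `getD` plays the role of the end marker.
  have hex : ∃ i, t % p.B ≤ bp.getD i p.B :=
    ⟨bp.length, by rw [List.getD_eq_default _ _ le_rfl]; exact hr.le⟩
  obtain ⟨z, hz, hzmin⟩ : ∃ z, t % p.B ≤ bp.getD z p.B ∧ ∀ i < z, bp.getD i p.B < t % p.B :=
    ⟨Nat.find hex, Nat.find_spec hex, fun i hi => not_le.1 (Nat.find_min hex hi)⟩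
  have hzl : z ≤ bp.length := by
    by_contra hc
    have := hzmin bp.length (not_le.1 hc)
    rw [List.getD_eq_default _ _ le_rfl] at this
    omega
  have hread : ∀ i ≤ bp.length, readWord p.w (d.label p) (d.ptr p k + i * p.e) % 2 ^ (p.lam + 2) =
      bp.getD i p.B := fun i hi => by
    rw [h.read_entry_mod hk (by omega), group_mod]
  have hkq : k / p.g < p.NC := by
    unfold Params.NC
    exact Nat.lt_succ_of_le (Nat.div_le_div_right hk.le)
  have hqk : k / p.g * p.g ≤ k := Nat.div_mul_le_self k p.g
  have hptr_mono : Monotone (d.ptr p) := monotone_nat_of_le_succ ptr_mono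
  have hbase_mono : Monotone (d.base p) := monotone_nat_of_le_succ h.base_mono
  have hptr : d.ptr p k < 2 ^ p.w := by simpa using h.ptr_add_le (i := 0) hk (by omega)
  have hK := h.hη (k * p.B)
  have hcap := h.hcap
  have hpe : 0 < 2 ^ p.e := by positivity
  have hBk : p.B * (k + 1) ≤ p.B * p.N := Nat.mul_le_mul_left _ hk
  rw [mul_add] at hcap hBk
  have hbaseK : d.base p k + p.B ≤ p.K + p.B * p.N := by unfold base; omega
  have hb := hbase_mono hqk
  -- Fewer than `g` digits remain, so the remainder is a valid index into the table.
  have hM : ∀ X, X % (2 ^ p.e) ^ (k % p.g) < p.tab := fun X => by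
    refine (Nat.mod_lt _ (by positivity)).trans_le ?_
    rw [← pow_mul]
    exact Nat.pow_le_pow_right (by omega) (Nat.mul_le_mul_left _ (Nat.mod_lt _ h.hg).le)
  have htabw : p.tab ≤ 2 ^ p.w := Nat.pow_le_pow_right (by omega) h.hgw
  have hc1 : chunk (2 ^ p.e) p.g (d.ptr p) (k / p.g) < 2 ^ p.w :=
    (chunk_lt ptr_mono ptr_step _).trans_le (by rw [← pow_mul]; exact htabw)
  have hc2 : chunk (2 ^ p.e) p.g (d.base p) (k / p.g) < 2 ^ p.w :=
    (chunk_lt h.base_mono h.base_step _).trans_le (by rw [← pow_mul]; exact htabw)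
  have ha : (mkItem p t δ).a = (9 + p.tab + 4 * (k / p.g)) * p.w := rfl
  have r0 : readWord p.w (d.label p) (mkItem p t δ).a = d.ptr p (k / p.g * p.g) := by
    simpa [ha] using h.read_record (i := 0) (v := d.ptr p (k / p.g * p.g)) hkq (by omega) rfl ((hptr_mono hqk).trans_lt hptr)
  have r1 : readWord p.w (d.label p) ((mkItem p t δ).a + p.w) =
      chunk (2 ^ p.e) p.g (d.ptr p) (k / p.g) := by
    simpa [ha] using h.read_record (i := 1)
      (v := chunk (2 ^ p.e) p.g (d.ptr p) (k / p.g)) hkq (by omega) rfl hc1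
  have r2 : readWord p.w (d.label p) ((mkItem p t δ).a + 2 * p.w) = d.base p (k / p.g * p.g) := by
    rw [ha]
    exact h.read_record (i := 2) hkq (by omega) rfl (show d.base p (k / p.g * p.g) < 2 ^ p.w by omega)
  have r3 : readWord p.w (d.label p) ((mkItem p t δ).a + 3 * p.w) =
      chunk (2 ^ p.e) p.g (d.base p) (k / p.g) := by
    rw [ha]
    exact h.read_record (i := 3) hkq (by omega) rfl hc2
  have hMi : (mkItem p t δ).M = (2 ^ p.e) ^ (k % p.g) := rfl
  have htb : p.consts.tb = 9 * p.w := rfl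
  have htgt : (mkItem p t δ).tgt = t % p.B := rfl
  refine ⟨z, hzl.trans hlB, ⟨?_, ?_, ?_, ?_, ?_, ?_, ?_, ?_, ?_⟩, ?_, ?_⟩
  · rw [ha]
    have h3 := h.mul_w_le (i := 9 + p.tab + 4 * (k / p.g) + 3)
      (by unfold nW Params.listStart; omega)
    have := h.hlen
    rw [add_mul] at h3
    omega
  · rw [r1, htb, hMi]
    exact (h.read_table (hM _)).1
  · rw [r3, htb, hMi]
    exact (h.read_table (hM _)).1
  · rw [r0, r1, htb, hMi, (h.read_table (hM _)).2]
    exact sampled_add_digitSum h.hg ptr_mono ptr_step k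
  · rw [r2, r3, htb, hMi, (h.read_table (hM _)).2]
    exact sampled_add_digitSum h.hg h.base_mono h.base_step k
  · exact h.ptr_add_le hk (by omega)
  · show d.base p k + 2 ^ p.e + (δ + 1) < 2 ^ p.w
    omega
  · intro i hi
    show readWord p.w (d.label p) (d.ptr p k + i * p.e) % 2 ^ (p.lam + 2) < t % p.B
    rw [hread i (by omega)]
    exact hzmin i hi
  · show t % p.B ≤ readWord p.w (d.label p) (d.ptr p k + z * p.e) % 2 ^ (p.lam + 2)
    rw [hread z hzl]
    exact hz
  · rw [hread z hzl]
    constructor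
    · intro he
      by_cases hzz : z < bp.length
      · rw [List.getD_eq_getElem _ _ hzz] at he
        have := (mem_blockPos.1 (List.getElem_mem hzz)).2
        rwa [he, htk] at this
      · rw [List.getD_eq_default _ _ (not_lt.1 hzz)] at he
        omega
    · intro htP
      have hmem : t % p.B ∈ bp := mem_blockPos.2 ⟨hr, by rwa [htk]⟩
      obtain ⟨i, hi, hie⟩ := List.getElem_of_mem hmem
      have hzi : z ≤ i := by
        by_contra hc
        have := hzmin i (not_le.1 hc)
        rw [List.getD_eq_getElem _ _ hi] at this
        omega
      rcases hzi.eq_or_lt with rfl | hlt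
      · rw [List.getD_eq_getElem _ _ hi, hie]
      · have hs : bp.Pairwise (· < ·) := List.Pairwise.filter _ List.pairwise_lt_range
        have h1 := List.pairwise_iff_getElem.1 hs z i (hlt.trans hi) hi hlt
        rw [List.getD_eq_getElem _ _ (hlt.trans hi)] at hz
        omega
  · intro htP
    have hmem : t % p.B ∈ bp := mem_blockPos.2 ⟨hr, by rwa [htk]⟩
    obtain ⟨i, hi, hie⟩ := List.getElem_of_mem hmem
    have hzi : z ≤ i := by
      by_contra hc
      have := hzmin i (not_le.1 hc)
      rw [List.getD_eq_getElem _ _ hi] at this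
      omega
    have hzz : z < bp.length := hzi.trans_lt hi
    have hze : bp[z] = t % p.B := by
      rcases hzi.eq_or_lt with rfl | hlt
      · exact hie
      · have hs : bp.Pairwise (· < ·) := List.Pairwise.filter _ List.pairwise_lt_range
        have h1 := List.pairwise_iff_getElem.1 hs z i hzz hi hlt
        rw [List.getD_eq_getElem _ _ hzz] at hz
        omega
    have hg : (d.group p k)[z]'(by omega) = d.entry p k (t % p.B) := by
      simp [group, ← hbp, hzz, hze]
    have hv : readWord p.w (d.label p) (d.ptr p k + z * p.e) % 2 ^ p.e / 2 ^ (p.lam + 2) =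
        d.η t + p.B - d.η (k * p.B) := by
      rw [h.read_entry hk (by omega), hg, entry_div hr, htk]
    have hlip := (h.lip_add (k * p.B) (t % p.B)).2
    rw [htk] at hlip
    have hS : (mkItem p t δ).S = p.B * (k + 1) := rfl
    have hD : (mkItem p t δ).D = δ + 1 := rfl
    have hvv : entryVal p.consts (mkItem p t δ) (d.base p k)
        (readWord p.w (d.label p) (d.ptr p k + z * p.e)) = d.base p k +
        readWord p.w (d.label p) (d.ptr p k + z * p.e) % 2 ^ p.e / 2 ^ (p.lam + 2) +
          (mkItem p t δ).D - (mkItem p t δ).S := rfl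
    rw [hvv, hv, hS, hD, base, mul_add]
    omega

/-- Labels with different component identifiers. -/
theorem Valid.decode_ne {d' : Content} (h : d.Valid p) (h' : d'.Valid p) (hc : d.comp ≠ d'.comp) :
    OutputsWithin p.w decoder (d.label p) (d'.label p) 20 ⊤ := by
  refine exec_decoder_ne ?_ h.header_ok h'.header_ok hc
  have := h.mul_w_le h.nine_le
  have := h.hlen
  omega

/-- Labels with the same component identifier: the decoder computes the smallest sum of distances
over the items of the second label that are hubs of the first one. -/
theorem Valid.decode_eq {d' : Content} (h : d.Valid p) (h' : d'.Valid p) (hc : d.comp = d'.comp)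
    (hne : ∃ i ∈ d'.items, i.1 ∈ d.P) :
    ∃ i ∈ d'.items, i.1 ∈ d.P ∧ (∀ i' ∈ d'.items, i'.1 ∈ d.P → d.η i.1 + i.2 ≤ d.η i'.1 + i'.2) ∧
      OutputsWithin p.w decoder (d.label p) (d'.label p) (d'.items.length * (41 + 4 * p.B) + 20)
        ((d.η i.1 + i.2 : ℕ) : ℕ∞) := by
  set m := d'.items.length with hm
  set I : ℕ → ℕ × ℕ := fun j => d'.items.getD j (0, 0) with hI
  have hImem : ∀ j < m, I j ∈ d'.items := fun j hj => by
    simp only [hI]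
    rw [List.getD_eq_getElem _ _ hj]
    exact List.getElem_mem _
  -- The premise `j < m` is placed inside so that `choose` yields a function on all of `ℕ`.
  have hsp : ∀ j, ∃ z, j < m → _ := fun j => by
    by_cases hj : j < m
    · obtain ⟨z, hz⟩ := h.item_spec (h'.hitems _ (hImem j hj)).1 (h'.hitems _ (hImem j hj)).2
      exact ⟨z, fun _ => hz⟩
    · exact ⟨0, fun hj' => absurd hj' hj⟩
  choose z hz using hsp
  have h9 := h.mul_w_le h.nine_le
  have hlen := h.hlen
  have hlen' := h'.hlen
  have hq : p.listStart * p.w + m * (5 * p.w) = d'.nW p * p.w := by unfold nW; ring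
  have hitw : ∀ j < m, ∀ i < 5, (d'.itemWords p j).getD i 0 < 2 ^ p.w := by
    intro j hj i hi
    have hs := (hz j hj).2.1
    have hit := h'.hitems _ (hImem j hj)
    have hk : (I j).1 / p.B < p.N := (Nat.div_lt_iff_lt_mul B_pos).2 hit.1
    have hBk : p.B * ((I j).1 / p.B + 1) ≤ p.B * p.N := Nat.mul_le_mul_left _ hk
    have hcap := h.hcap
    have hpe : 0 < 2 ^ p.e := by positivity
    have hv := hs.hval
    have ha := hs.ha
    rw [mul_add p.B p.N] at hcap
    have hM : (2 ^ p.e) ^ ((I j).1 / p.B % p.g) < 2 ^ p.w := by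
      rw [← pow_mul]
      refine Nat.pow_lt_pow_right (by omega) (lt_of_lt_of_le ?_ h.hgw)
      exact Nat.mul_lt_mul_of_pos_left (Nat.mod_lt _ h.hg) (by unfold Params.e; omega)
    have ht := Nat.mod_lt (I j).1 (B_pos (p := p))
    have hD : (mkItem p (I j).1 (I j).2).D = (I j).2 + 1 := rfl
    match i, hi with
    | 0, _ => exact lt_of_le_of_lt (Nat.le_add_right _ _) ha
    | 1, _ => exact hM
    | 2, _ => exact show (I j).1 % p.B < 2 ^ p.w by omega
    | 3, _ => exact show (I j).2 + 1 < 2 ^ p.w by omega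
    | 4, _ => exact show p.B * ((I j).1 / p.B + 1) < 2 ^ p.w by omega
  have hrd : ∀ j < m, ∀ i < 5, readWord p.w (d'.label p)
      (p.listStart * p.w + j * (5 * p.w) + i * p.w) = (d'.itemWords p j).getD i 0 :=
    fun j hj i hi => h'.read_itemWord hj hi rfl (hitw j hj i hi)
  obtain ⟨k, s, hk, hx, hle, hor, hmin⟩ := exec_decoder_eq (m := m) (Z := p.B)
    (it := fun j => mkItem p (I j).1 (I j).2) (p := fun j => d.ptr p ((I j).1 / p.B))
    (β := fun j => d.base p ((I j).1 / p.B)) (z := z) h.w_pos (by omega) h.header_ok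
    (hc ▸ h'.header_ok) (by rw [hq]; omega) (by simp [Params.consts])
    (fun j hj => by
      have := hrd j hj 0 (by omega)
      rw [zero_mul, add_zero] at this
      exact this)
    (fun j hj => by
      have := hrd j hj 1 (by omega)
      rw [one_mul] at this
      exact this)
    (fun j hj => hrd j hj 2 (by omega))
    (fun j hj => hrd j hj 3 (by omega))
    (fun j hj => hrd j hj 4 (by omega))
    (fun j hj => (hz j hj).2.1) (fun j hj => (hz j hj).1)
    (fun j hj hh => ((hz j hj).2.2.2 ((hz j hj).2.2.1.1 hh)).1)
  have hmin' : ∀ i' ∈ d'.items, i'.1 ∈ d.P → s.reg 0 ≤ d.η i'.1 + i'.2 + 1 := by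
    intro i' hi' hP
    obtain ⟨j, hj, rfl⟩ := List.getElem_of_mem hi'
    have hIj : I j = d'.items[j] := List.getD_eq_getElem _ _ hj
    rw [← hIj] at hP ⊢
    have := hmin j hj ((hz j hj).2.2.1.2 hP)
    exact this.trans_eq ((hz j hj).2.2.2 hP).2
  rcases hor with hor | ⟨j, hj, hh, hv⟩
  -- The initial value 2K + 2 cannot survive: the common hub gives a candidate of at most 2K + 1.
  · exfalso
    obtain ⟨i, hi, hP⟩ := hne
    have h1 := hmin' i hi hP
    have h2 := (h'.hitems i hi).2
    have h3 := h.hη i.1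
    omega
  · have hP := (hz j hj).2.2.1.1 hh
    have hv' : s.reg 0 = d.η (I j).1 + (I j).2 + 1 := by
      rw [hv]; exact ((hz j hj).2.2.2 hP).2
    refine ⟨I j, hImem j hj, hP, fun i' hi' hP' => ?_, k, s, hk, hx, ?_⟩
    · have := hmin' i' hi' hP'
      omega
    · simp [State.output, hv']

end Content

end DistLabel

namespace DistLabel

/-! ## Cheapest paths -/

section Paths

variable {V : Type*} {G : SimpleGraph V} {cost : Sym2 V → ℕ}

theorem walkCost_nil (u : V) : walkCost G cost (SimpleGraph.Walk.nil : G.Walk u u) = 0 := by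
  simp [walkCost]

theorem walkCost_append {u v x : V} (p : G.Walk u v) (q : G.Walk v x) :
    walkCost G cost (p.append q) = walkCost G cost p + walkCost G cost q := by
  simp [walkCost]

theorem walkCost_reverse {u v : V} (p : G.Walk u v) :
    walkCost G cost p.reverse = walkCost G cost p := by
  simp [walkCost, List.map_reverse]

theorem walkCost_le_length (hc : ∀ e ∈ G.edgeSet, cost e ≤ 1) {u v : V} (p : G.Walk u v) :
    walkCost G cost p ≤ p.length := by
  rw [← p.length_edges, walkCost]
  refine (List.sum_le_card_nsmul _ 1 ?_).trans (by simp)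
  simp only [List.mem_map]
  rintro _ ⟨e, he, rfl⟩
  exact hc e (p.edges_subset_edgeSet he)

theorem delta_le {u v : V} (p : G.Walk u v) : delta G cost u v ≤ walkCost G cost p :=
  iInf_le _ p

theorem delta_self (u : V) : delta G cost u u = 0 :=
  nonpos_iff_eq_zero.1 ((delta_le SimpleGraph.Walk.nil).trans (by simp [walkCost_nil]))

theorem delta_comm (u v : V) : delta G cost u v = delta G cost v u := by
  apply le_antisymm <;> exact le_iInf fun p => by
    rw [← walkCost_reverse]; exact delta_le _

theorem delta_eq_top {u v : V} (h : ¬ G.Reachable u v) : delta G cost u v = ⊤ := by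
  have : IsEmpty (G.Walk u v) := ⟨fun p => h ⟨p⟩⟩
  simp [delta]

theorem exists_walk_eq_delta {u v : V} (h : G.Reachable u v) :
    ∃ p : G.Walk u v, (walkCost G cost p : ℕ∞) = delta G cost u v := by
  have : Nonempty (G.Walk u v) := h
  obtain ⟨p, hp⟩ := ciInf_mem fun p : G.Walk u v => (walkCost G cost p : ℕ∞)
  exact ⟨p, hp⟩

theorem delta_triangle (u v x : V) : delta G cost u x ≤ delta G cost u v + delta G cost v x := by
  by_cases h : G.Reachable u v
  · by_cases h' : G.Reachable v x
    · obtain ⟨p, hp⟩ := exists_walk_eq_delta (cost := cost) h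
      obtain ⟨q, hq⟩ := exists_walk_eq_delta (cost := cost) h'
      rw [← hp, ← hq, ← Nat.cast_add, ← walkCost_append]
      exact delta_le _
    · simp [delta_eq_top h']
  · simp [delta_eq_top h]

theorem delta_le_one (hc : ∀ e ∈ G.edgeSet, cost e ≤ 1) {u v : V} (h : G.Adj u v) :
    delta G cost u v ≤ 1 := by
  refine (delta_le h.toWalk).trans ?_
  have := walkCost_le_length hc h.toWalk
  rw [SimpleGraph.Adj.length_toWalk] at this
  exact_mod_cast this

/-- The distance as a natural number; `0` for unreachable pairs. -/
noncomputable def natDist (G : SimpleGraph V) (cost : Sym2 V → ℕ) (u v : V) : ℕ :=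
  (delta G cost u v).toNat

theorem coe_natDist {u v : V} (h : G.Reachable u v) : (natDist G cost u v : ℕ∞) = delta G cost u v := by
  obtain ⟨p, hp⟩ := exists_walk_eq_delta (cost := cost) h
  rw [natDist, ← hp, ENat.toNat_natCast]

theorem natDist_le_card [Fintype V] (hc : ∀ e ∈ G.edgeSet, cost e ≤ 1) (u v : V) :
    natDist G cost u v ≤ Fintype.card V := by
  classical
  by_cases h : G.Reachable u v
  · obtain ⟨p, hp⟩ := h.exists_isPath
    have h1 : (natDist G cost u v : ℕ∞) ≤ walkCost G cost p := by rw [coe_natDist h]; exact delta_le p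
    have h1 : natDist G cost u v ≤ walkCost G cost p := by exact_mod_cast h1
    exact h1.trans ((walkCost_le_length hc p).trans hp.length_lt.le)
  · simp [natDist, delta_eq_top h]

/-- Applied in both directions along a tour, this is the Lipschitz property behind the short
encoding of distances. -/
theorem natDist_le_add_one (hc : ∀ e ∈ G.edgeSet, cost e ≤ 1) {u x y : V} (hx : G.Reachable u x)
    (h : x = y ∨ G.Adj x y) : natDist G cost u y ≤ natDist G cost u x + 1 := by
  rcases h with rfl | h
  · omega
  · have h1 := (delta_triangle (cost := cost) u x y).trans
      (add_le_add_right (delta_le_one hc h) (delta G cost u x))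
    rw [← coe_natDist hx, ← coe_natDist (hx.trans h.reachable)] at h1
    exact_mod_cast h1

theorem exists_walk_ell {u v : V} (h : G.Reachable u v) :
    ∃ p : G.Walk u v, (walkCost G cost p : ℕ∞) = delta G cost u v ∧ p.length = ell G cost u v := by
  obtain ⟨p, hp⟩ := exists_walk_eq_delta (cost := cost) h
  exact Nat.sInf_mem (s := {k | ∃ p : G.Walk u v, (walkCost G cost p : ℕ∞) = delta G cost u v ∧
    p.length = k}) ⟨_, p, hp, rfl⟩

theorem ell_le {u v : V} (p : G.Walk u v) (hp : (walkCost G cost p : ℕ∞) = delta G cost u v) :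
    ell G cost u v ≤ p.length :=
  Nat.sInf_le ⟨p, hp, rfl⟩

/-- Vertices of a cheapest path with fewest edges. -/
theorem ell_getVert {u v : V} {q : G.Walk u v} (hq : (walkCost G cost q : ℕ∞) = delta G cost u v)
    (hl : q.length = ell G cost u v) {i : ℕ} (hi : i ≤ q.length) :
    ell G cost u (q.getVert i) = i ∧
      delta G cost u v = delta G cost u (q.getVert i) + delta G cost (q.getVert i) v := by
  have hsum : walkCost G cost q = walkCost G cost (q.take i) + walkCost G cost (q.drop i) := by
    rw [← walkCost_append, SimpleGraph.Walk.append_take_drop_eq]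
  have hr1 : G.Reachable u (q.getVert i) := ⟨q.take i⟩
  have hr2 : G.Reachable (q.getVert i) v := ⟨q.drop i⟩
  have h1 := delta_le (cost := cost) (q.take i)
  have h2 := delta_le (cost := cost) (q.drop i)
  have h3 := delta_triangle (G := G) (cost := cost) u (q.getVert i) v
  have h1' := coe_natDist (cost := cost) hr1
  have h2' := coe_natDist (cost := cost) hr2
  rw [← h1', Nat.cast_le] at h1
  rw [← h2', Nat.cast_le] at h2
  rw [← hq, ← h1', ← h2', ← Nat.cast_add, Nat.cast_le] at h3
  -- The triangle inequality and the optimality of `q` leave no slack: both parts of `q` are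
  -- cheapest.
  have e1 : walkCost G cost (q.take i) = natDist G cost u (q.getVert i) := by omega
  have e2 : walkCost G cost (q.drop i) = natDist G cost (q.getVert i) v := by omega
  refine ⟨le_antisymm ?_ ?_, ?_⟩
  · have := ell_le (q.take i) (by rw [e1, h1'])
    rw [SimpleGraph.Walk.take_length] at this
    omega
  -- Replacing the first part of `q` by a cheapest walk with fewest edges gives a cheapest u-v walk,
  -- which cannot have fewer edges than `q`.
  · obtain ⟨r, hr, hrl⟩ := exists_walk_ell (cost := cost) hr1
    have := ell_le (r.append (q.drop i)) (by
      rw [← hq, walkCost_append, hsum, Nat.cast_add, hr, ← h1', e1, Nat.cast_add])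
    rw [SimpleGraph.Walk.length_append, SimpleGraph.Walk.drop_length] at this
    omega
  · rw [← hq, hsum, e1, e2, Nat.cast_add, h1', h2']

/-! ### Restricted balls and the existence of a common hub -/

theorem lowBall_mono {τ r r' : ℕ} (h : r ≤ r') (u : V) : lowBall G τ r u ⊆ lowBall G τ r' u :=
  fun _ ⟨p, hp, hs⟩ => ⟨p, hp.trans h, hs⟩

theorem mem_lowBall_self {τ r : ℕ} {u : V} (h : u ∉ highDeg G τ) : u ∈ lowBall G τ r u :=
  ⟨.nil, by simp, by simpa using h⟩

theorem mem_lowBall_succ {τ r : ℕ} {u x y : V} (hx : x ∈ lowBall G τ r u) (h : G.Adj x y)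
    (hy : y ∉ highDeg G τ) : y ∈ lowBall G τ (r + 1) u := by
  obtain ⟨p, hp, hs⟩ := hx
  refine ⟨p.concat h, by simpa using hp, fun z hz => ?_⟩
  rw [SimpleGraph.Walk.support_concat, List.mem_append,
    List.mem_singleton] at hz
  rcases hz with hz | rfl
  exacts [hs z hz, hy]

/-- The hubs of `v` that are looked up in the label of another vertex: the restricted ball of `v`,
and the dominators `s y` of the vertices `y` of high degree that are `v` or next to the ball. -/
def ownHubs (G : SimpleGraph V) (τ r : ℕ) (s : V → V) (v : V) : Set V :=
  lowBall G τ r v ∪ s '' {y | y ∈ highDeg G τ ∧ (y = v ∨ ∃ x ∈ lowBall G τ r v, G.Adj x y)}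

/-- The roles are asymmetric: the ball and the dominators next to it come from `v`, the layer class
and all of `D` from `u`. This keeps the number of candidates to be tested small. -/
theorem exists_hub (hc : ∀ e ∈ G.edgeSet, cost e ≤ 1) {τ : ℕ} {D : Set V} {offset : V → ℕ}
    {s : V → V} (hs : ∀ y ∈ highDeg G τ, s y ∈ D ∧ (s y = y ∨ G.Adj y (s y))) {u v : V}
    (hoff : offset u < radius τ) (h : G.Reachable u v) :
    ∃ w ∈ ownHubs G τ (radius τ) s v, w ∈ hubs G cost τ D offset u ∧ G.Reachable u w ∧
      delta G cost u w + delta G cost w v ≤ delta G cost u v + 2 := by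
  obtain ⟨q, hq, hl⟩ := exists_walk_ell (cost := cost) h
  set R := radius τ
  -- `x i` is the vertex `i` steps before `v` on the path.
  set x : ℕ → V := fun i => q.getVert (q.length - i) with hx
  have hx0 : x 0 = v := by simp [hx]
  have hxl : x q.length = u := by simp [hx]
  have hadj : ∀ i < q.length, G.Adj (x i) (x (i + 1)) := fun i hi => by
    have := q.adj_getVert_succ (i := q.length - (i + 1)) (by omega)
    rw [show q.length - (i + 1) + 1 = q.length - i by omega] at this
    exact this.symm
  have hball : ∀ i ≤ q.length, (∀ j ≤ i, x j ∉ highDeg G τ) → x i ∈ lowBall G τ i v := by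
    intro i
    induction i with
    | zero => intro _ hlow; rw [hx0]; exact mem_lowBall_self (by simpa [hx0] using hlow 0 le_rfl)
    | succ i ih =>
      intro hi hlow
      exact mem_lowBall_succ (ih (by omega) fun j hj => hlow j (by omega)) (hadj i (by omega))
        (hlow _ le_rfl)
  have hreach : ∀ i, G.Reachable u (x i) := fun i => ⟨q.take _⟩
  have hsplit : ∀ i, delta G cost u (x i) + delta G cost (x i) v = delta G cost u v :=
    fun i => (ell_getVert hq hl (Nat.sub_le _ _)).2.symm
  by_cases hex : ∃ i, i ≤ q.length ∧ i ≤ R ∧ x i ∈ highDeg G τ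
  · classical
    obtain ⟨i, ⟨hil, hiR, hi⟩, hmin⟩ : ∃ i, (i ≤ q.length ∧ i ≤ R ∧ x i ∈ highDeg G τ) ∧
        ∀ j < i, ¬ (j ≤ q.length ∧ j ≤ R ∧ x j ∈ highDeg G τ) :=
      ⟨Nat.find hex, Nat.find_spec hex, fun j hj => Nat.find_min hex hj⟩
    obtain ⟨hD, hsa⟩ := hs _ hi
    have hle : delta G cost (x i) (s (x i)) ≤ 1 := by
      rcases hsa with hsa | hsa
      · rw [hsa, delta_self]; exact bot_le
      · exact delta_le_one hc hsa
    refine ⟨s (x i), Or.inr ⟨x i, ⟨hi, ?_⟩, rfl⟩, Or.inr hD, (hreach i).trans ?_, ?_⟩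
    · cases i with
      | zero => exact Or.inl hx0
      | succ i =>
        refine Or.inr ⟨x i, lowBall_mono (by omega) _ (hball i (by omega) fun j hj hjh => ?_),
          hadj i (by omega)⟩
        exact hmin j (by omega) ⟨by omega, by omega, hjh⟩
    · rcases hsa with hsa | hsa
      · rw [hsa]
      · exact hsa.reachable
    -- The detour from the path to the dominator and back costs at most 1 each way.
    · calc delta G cost u (s (x i)) + delta G cost (s (x i)) v
          ≤ (delta G cost u (x i) + 1) + (1 + delta G cost (x i) v) := by
            gcongr
            · exact (delta_triangle _ (x i) _).trans (by gcongr)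
            · refine (delta_triangle _ (x i) _).trans ?_
              rw [delta_comm (s (x i))]
              gcongr
        _ = delta G cost u (x i) + delta G cost (x i) v + 2 := by ring
        _ = _ := by rw [hsplit]
  · push Not at hex
    by_cases hR : R ≤ q.length
    -- Since ℓ(u, x i) is `q.length - i`, this is the index below R for which it is congruent to the
    -- offset.
    · set i := (q.length - offset u) % R with hidef
      have hiR : i < R := Nat.mod_lt _ (by omega)
      refine ⟨x i, Or.inl (lowBall_mono hiR.le _ (hball i (by omega)
        fun j hj => hex j (by omega) (by omega))), Or.inl (Or.inr ⟨hreach i, ?_⟩), hreach i, ?_⟩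
      · rw [(ell_getVert hq hl (Nat.sub_le _ _)).1]
        have hdm := Nat.div_add_mod (q.length - offset u) R
        rw [← hidef] at hdm
        have he : q.length - i = offset u + R * ((q.length - offset u) / R) := by omega
        rw [he]
        exact Nat.add_mul_mod_self_left _ _ _
      · rw [hsplit]; exact le_self_add
    -- The path is short and avoids high degrees altogether, so `u` itself is in the ball of `v`.
    · have hlow : ∀ j ≤ q.length, x j ∉ highDeg G τ := fun j hj => hex j hj (by omega)
      refine ⟨u, Or.inl ?_, Or.inl (Or.inl (mem_lowBall_self (hxl ▸ hlow _ le_rfl))),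
        .refl _, ?_⟩
      · have := hball q.length le_rfl hlow
        rw [hxl] at this
        exact lowBall_mono (by omega) _ this
      · rw [delta_self, zero_add]; exact le_self_add

theorem ownHubs_subset_hubs {τ : ℕ} {D : Set V} {offset : V → ℕ} {s : V → V}
    (hs : ∀ y ∈ highDeg G τ, s y ∈ D ∧ (s y = y ∨ G.Adj y (s y))) (v : V) :
    ownHubs G τ (radius τ) s v ⊆ hubs G cost τ D offset v := by
  rintro w (hw | ⟨y, ⟨hy, -⟩, rfl⟩)
  · exact Or.inl (Or.inl hw)
  · exact Or.inr (hs y hy).1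

end Paths

end DistLabel

namespace DistLabel

/-! ## Tours, balls, layers, dominating sets -/

theorem lowBall_succ_subset {V : Type*} {G : SimpleGraph V} (τ r : ℕ) (u : V) :
    lowBall G τ (r + 1) u ⊆ {u} ∪ ⋃ x ∈ G.neighborSet u, lowBall G τ r x := by
  rintro v ⟨p, hp, hs⟩
  cases p with
  | nil => exact Or.inl rfl
  | cons h q =>
    refine Or.inr (Set.mem_iUnion₂.2 ⟨_, h, q, by simpa using hp, fun x hx => hs x ?_⟩)
    simp [hx]

section Counting

variable {V : Type*} [Fintype V] {G : SimpleGraph V} {cost : Sym2 V → ℕ}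

/-- A closed walk through a whole component. -/
theorem exists_closed_walk (r : V) :
    ∃ p : G.Walk r r, p.length ≤ 2 * Fintype.card V - 2 ∧ ∀ v, G.Reachable r v → v ∈ p.support := by
  classical
  -- Extremal choice: among closed walks of length at most twice the number of visited vertices
  -- minus 2, take one visiting the most vertices.
  let good : ℕ → Prop := fun k => ∃ p : G.Walk r r, p.length + 2 ≤ 2 * p.support.toFinset.card ∧
    k = p.support.toFinset.card
  have h1 : good 1 := ⟨.nil, by simp, by simp⟩
  have hbd : ∀ k, good k → k ≤ Fintype.card V := by
    rintro k ⟨p, -, rfl⟩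
    exact Finset.card_le_univ _
  obtain ⟨p, hp, hk⟩ : good (Nat.findGreatest good (Fintype.card V)) :=
    Nat.findGreatest_spec (hbd _ h1) h1
  refine ⟨p, ?_, fun v ⟨q⟩ => ?_⟩
  · have := Finset.card_le_univ p.support.toFinset
    omega
  · by_contra hv
    obtain ⟨d, -, ha, hb⟩ := q.exists_boundary_dart {x | x ∈ p.support} p.start_mem_support hv
    have ha : d.fst ∈ p.support := ha
    have hb : d.snd ∉ p.support := hb
    -- Going back and forth over an edge that leaves the visited set adds two edges and a new
    -- vertex, contradicting maximality.
    let p' : G.Walk r r := (p.takeUntil _ ha).append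
      (.cons d.adj (.cons d.adj.symm (p.dropUntil _ ha)))
    have hlen : p'.length = p.length + 2 := by
      have := congrArg SimpleGraph.Walk.length (p.take_spec ha)
      rw [SimpleGraph.Walk.length_append] at this
      simp only [p', SimpleGraph.Walk.length_append, SimpleGraph.Walk.length_cons]
      omega
    have hsub : insert d.snd p.support.toFinset ⊆ p'.support.toFinset := by
      intro x hx
      rw [Finset.mem_insert, List.mem_toFinset] at hx
      rw [List.mem_toFinset]
      simp only [p', SimpleGraph.Walk.mem_support_append_iff, SimpleGraph.Walk.support_cons,
        List.mem_cons]
      rcases hx with rfl | hx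
      · simp
      · rw [← p.take_spec ha, SimpleGraph.Walk.mem_support_append_iff] at hx
        tauto
    have hcard := Finset.card_le_card hsub
    rw [Finset.card_insert_of_notMem (by simpa using hb)] at hcard
    have hg : good p'.support.toFinset.card := ⟨p', by omega, rfl⟩
    have := Nat.le_findGreatest (hbd _ hg) hg
    omega

/-- A tour of a component: a sequence of vertices in which consecutive ones are equal or adjacent
and that visits all vertices of the component early. -/
theorem exists_tour (r : V) :
    ∃ f : ℕ → V, (∀ i, f i = f (i + 1) ∨ G.Adj (f i) (f (i + 1))) ∧ (∀ i, G.Reachable r (f i)) ∧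
      ∀ v, G.Reachable r v → ∃ i < 2 * Fintype.card V, f i = v := by
  obtain ⟨p, hp, hv⟩ := exists_closed_walk (G := G) r
  refine ⟨p.getVert, fun i => ?_, fun i => ⟨p.take i⟩, fun v h => ?_⟩
  · by_cases hi : i < p.length
    · exact Or.inr (p.adj_getVert_succ hi)
    -- Beyond the end of the walk, `getVert` stays at the last vertex.
    · left
      rw [p.getVert_of_length_le (not_lt.1 hi), p.getVert_of_length_le (by omega)]
  · obtain ⟨i, hi, hil⟩ := SimpleGraph.Walk.mem_support_iff_exists_getVert.1 (hv v h)
    have : 0 < Fintype.card V := Fintype.card_pos_iff.2 ⟨r⟩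
    exact ⟨i, by omega, hi⟩

/-- A centre of high degree has an empty ball; any other contributes itself and at most τ balls of
smaller radius. -/
theorem ncard_lowBall_le {τ : ℕ} (hτ : 1 ≤ τ) (r : ℕ) (u : V) :
    (lowBall G τ r u).ncard ≤ (r + 1) * τ ^ r := by
  classical
  induction r generalizing u with
  | zero =>
    have : lowBall G τ 0 u ⊆ {u} := by
      rintro v ⟨p, hp, -⟩
      exact (p.eq_of_length_eq_zero (Nat.le_zero.1 hp)).symm
    simpa using Set.ncard_le_ncard this
  | succ r ih =>
    by_cases hu : u ∈ highDeg G τ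
    · have : lowBall G τ (r + 1) u = ∅ :=
        Set.eq_empty_of_forall_notMem fun v ⟨p, _, hs⟩ => hs u p.start_mem_support hu
      simp [this]
    · have hdeg : (G.neighborSet u).ncard ≤ τ := not_lt.1 hu
      have h1 := (Set.ncard_le_ncard (lowBall_succ_subset (G := G) τ r u)).trans
        (Set.ncard_union_le _ _)
      rw [Set.ncard_singleton] at h1
      have h2 : (⋃ x ∈ G.neighborSet u, lowBall G τ r x).ncard ≤ τ * ((r + 1) * τ ^ r) := by
        have hfin : (G.neighborSet u).Finite := Set.toFinite _
        have he : (⋃ x ∈ G.neighborSet u, lowBall G τ r x) =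
            ⋃ x ∈ hfin.toFinset, lowBall G τ r x := by simp
        rw [he]
        refine (Finset.set_ncard_biUnion_le _ _).trans ?_
        refine (Finset.sum_le_card_nsmul _ _ _ fun x _ => ih x).trans ?_
        rw [smul_eq_mul, ← Set.ncard_eq_toFinset_card _ hfin]
        exact Nat.mul_le_mul_right _ hdeg
      have h3 : 1 ≤ τ ^ (r + 1) := Nat.one_le_pow _ _ hτ
      calc _ ≤ 1 + τ * ((r + 1) * τ ^ r) := by omega
        _ ≤ τ ^ (r + 1) + τ * ((r + 1) * τ ^ r) := by omega
        _ = (r + 1 + 1) * τ ^ (r + 1) := by ring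

/-- Each vertex of the ball has at most τ neighbours; the last summand accounts for `v` itself. -/
theorem ncard_ownHubs_le {τ : ℕ} (r : ℕ) (s : V → V) (v : V) :
    (ownHubs G τ r s v).ncard ≤ (τ + 1) * (lowBall G τ r v).ncard + 1 := by
  classical
  have hfin : (lowBall G τ r v).Finite := Set.toFinite _
  have h1 : {y | y ∈ highDeg G τ ∧ (y = v ∨ ∃ x ∈ lowBall G τ r v, G.Adj x y)} ⊆
      {v} ∪ ⋃ x ∈ hfin.toFinset, G.neighborSet x := by
    rintro y ⟨-, rfl | ⟨x, hx, ha⟩⟩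
    · exact Or.inl rfl
    · exact Or.inr (Set.mem_iUnion₂.2 ⟨x, by simpa using hx, ha⟩)
  have h2 : (⋃ x ∈ hfin.toFinset, G.neighborSet x).ncard ≤ (lowBall G τ r v).ncard * τ := by
    refine (Finset.set_ncard_biUnion_le _ _).trans ?_
    refine (Finset.sum_le_card_nsmul _ _ τ fun x hx => ?_).trans ?_
    · obtain ⟨p, -, hs⟩ := hfin.mem_toFinset.1 hx
      exact not_lt.1 (hs x p.end_mem_support)
    · rw [smul_eq_mul, ← Set.ncard_eq_toFinset_card _ hfin]
  have h3 := (Set.ncard_le_ncard h1).trans (Set.ncard_union_le _ _)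
  rw [Set.ncard_singleton] at h3
  have h4 : (s '' {y | y ∈ highDeg G τ ∧ (y = v ∨ ∃ x ∈ lowBall G τ r v, G.Adj x y)}).ncard ≤ _ :=
    Set.ncard_image_le (Set.toFinite _)
  have h5 := Set.ncard_union_le (lowBall G τ r v)
    (s '' {y | y ∈ highDeg G τ ∧ (y = v ∨ ∃ x ∈ lowBall G τ r v, G.Adj x y)})
  unfold ownHubs
  rw [add_mul, one_mul, Nat.mul_comm τ]
  omega

/-- Some layer class is small. -/
theorem exists_offset {R : ℕ} (hR : 0 < R) (u : V) :
    ∃ k < R, (layer G cost R k u).ncard * R ≤ Fintype.card V := by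
  classical
  have hne : (Finset.range R).Nonempty := ⟨0, Finset.mem_range.2 hR⟩
  have hdisj : Set.PairwiseDisjoint (Finset.range R : Set ℕ) fun k => layer G cost R k u := by
    intro a ha b hb hab
    rw [Finset.mem_coe, Finset.mem_range] at ha hb
    refine Set.disjoint_left.2 fun v h1 h2 => hab ?_
    have := h1.2.symm.trans h2.2
    rwa [Nat.ModEq, Nat.mod_eq_of_lt ha, Nat.mod_eq_of_lt hb] at this
  have hsum : ∑ k ∈ Finset.range R, (layer G cost R k u).ncard ≤ Fintype.card V := by
    simp only [Set.ncard_eq_toFinset_card']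
    rw [← Finset.card_biUnion]
    · exact Finset.card_le_univ _
    · intro a ha b hb hab
      rw [Function.onFun, Set.disjoint_toFinset]
      exact hdisj ha hb hab
  obtain ⟨k, hk, hle⟩ := Finset.exists_le_of_sum_le (s := Finset.range R)
    (f := fun k => (layer G cost R k u).ncard * R) (g := fun _ => Fintype.card V) hne (by
      rw [← Finset.sum_mul, Finset.sum_const, Finset.card_range, smul_eq_mul, Nat.mul_comm]
      exact Nat.mul_le_mul_left _ hsum)
  exact ⟨k, Finset.mem_range.1 hk, hle⟩

/-- Greedy covering: `k` elements leave at most a fraction `(1 - m / n) ^ k` uncovered. -/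
theorem exists_cover (r : V → V → Prop) {m : ℕ} (A : Finset V)
    (hm : ∀ v ∈ A, m ≤ {x | r v x}.ncard) (hn : 0 < Fintype.card V)
    (hmn : m ≤ Fintype.card V) (k : ℕ) :
    ∃ D U : Finset V, D.card ≤ k ∧ U ⊆ A ∧ (∀ v ∈ A, v ∈ U ∨ ∃ x ∈ D, r v x) ∧
      (U.card : ℝ) ≤ Fintype.card V * (1 - m / Fintype.card V) ^ k := by
  classical
  have hn' : (0 : ℝ) < Fintype.card V := by exact_mod_cast hn
  induction k with
  | zero =>
    exact ⟨∅, A, by simp, subset_rfl, fun v hv => Or.inl hv, by simpa using Finset.card_le_univ A⟩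
  | succ k ih =>
    obtain ⟨D, U, hD, hUA, hcov, hU⟩ := ih
    have hdc : ∑ x : V, (U.filter fun v => r v x).card =
        ∑ v ∈ U, (Finset.univ.filter (r v)).card :=
      (Finset.sum_card_bipartiteAbove_eq_sum_card_bipartiteBelow (s := U) (t := Finset.univ) r).symm
    have hne : (Finset.univ : Finset V).Nonempty :=
      Finset.univ_nonempty_iff.2 (Fintype.card_pos_iff.1 hn)
    -- By double counting and averaging, some `x` covers at least a fraction m / n of `U`.
    obtain ⟨x, -, hx⟩ := Finset.exists_le_of_sum_le (s := (Finset.univ : Finset V))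
      (f := fun _ => U.card * m) (g := fun x => (U.filter fun v => r v x).card * Fintype.card V)
      hne (by
        rw [Finset.sum_const, ← Finset.sum_mul, hdc, smul_eq_mul, Finset.card_univ, Nat.mul_comm]
        refine Nat.mul_le_mul_right _ ?_
        rw [← smul_eq_mul]
        refine Finset.card_nsmul_le_sum _ _ _ fun v hv => (hm v (hUA hv)).trans_eq ?_
        rw [Set.ncard_eq_toFinset_card', Set.toFinset_ofPred])
    have hsplit := Finset.card_filter_add_card_filter_not (s := U) fun v => r v x
    refine ⟨insert x D, U.filter fun v => ¬ r v x, (Finset.card_insert_le _ _).trans (by omega),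
      (Finset.filter_subset _ _).trans hUA, fun v hv => ?_, ?_⟩
    · rcases hcov v hv with h | ⟨y, hy, h⟩
      · by_cases hr : r v x
        · exact Or.inr ⟨x, Finset.mem_insert_self _ _, hr⟩
        · exact Or.inl (Finset.mem_filter.2 ⟨h, hr⟩)
      · exact Or.inr ⟨y, Finset.mem_insert_of_mem hy, h⟩
    have h2 : ((U.filter fun v => ¬ r v x).card : ℝ) = U.card - (U.filter fun v => r v x).card := by
      rw [eq_sub_iff_add_eq, add_comm]
      exact_mod_cast hsplit
    have h3 : (U.card : ℝ) * (m / Fintype.card V) ≤ (U.filter fun v => r v x).card := by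
      rw [← mul_div_assoc, div_le_iff₀ hn']
      exact_mod_cast hx
    have h4 : (0 : ℝ) ≤ 1 - m / Fintype.card V := by
      rw [sub_nonneg, div_le_one hn']
      exact_mod_cast hmn
    calc _ ≤ (U.card : ℝ) * (1 - m / Fintype.card V) := by rw [h2]; linarith
      _ ≤ (Fintype.card V * (1 - m / Fintype.card V) ^ k) * (1 - m / Fintype.card V) :=
        mul_le_mul_of_nonneg_right hU h4
      _ = _ := by ring

/-- The vertices of degree greater than `τ` are dominated by few vertices. -/
theorem exists_dominating {τ l : ℕ} (hτ : 1 ≤ τ) (hτn : τ ≤ Fintype.card V) (hl : τ ≤ 2 ^ l)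
    (hl0 : 1 ≤ l) :
    ∃ D : Finset V, Dominates G D (highDeg G τ) ∧ D.card * τ ≤ 3 * Fintype.card V * l := by
  classical
  set n := Fintype.card V with hn
  have hn0 : 0 < n := by omega
  have hn' : (0 : ℝ) < n := by exact_mod_cast hn0
  have hτ' : (0 : ℝ) < τ := by exact_mod_cast hτ
  set A : Finset V := Finset.univ.filter fun v => v ∈ highDeg G τ with hA
  -- After this many rounds at most n · exp(-l) ≤ n / τ vertices are uncovered; they are added to
  -- the dominating set themselves.
  set k := ⌊(n * l : ℝ) / τ⌋₊ + 1 with hk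
  obtain ⟨D, U, hD, -, hcov, hU⟩ := exists_cover (fun v x => x = v ∨ G.Adj v x) (m := τ) A
    (fun v hv => by
      have hv : τ < (G.neighborSet v).ncard := (Finset.mem_filter.1 hv).2
      exact hv.le.trans (Set.ncard_le_ncard fun x hx => Or.inr hx)) hn0 hτn k
  rw [← hn] at hU
  refine ⟨D ∪ U, fun v hv => ?_, ?_⟩
  · rcases hcov v (by simpa [hA] using hv) with h | ⟨x, hx, h⟩
    · exact ⟨v, by simp [h], Or.inl rfl⟩
    · exact ⟨x, by simp [hx], h⟩
  · have hkl : (n * l : ℝ) ≤ k * τ := by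
      have := Nat.lt_floor_add_one ((n * l : ℝ) / τ)
      rw [div_lt_iff₀ hτ'] at this
      rw [hk]; push_cast; exact this.le
    have hku : (k : ℝ) * τ ≤ n * l + τ := by
      have := Nat.floor_le (show (0 : ℝ) ≤ (n * l : ℝ) / τ by positivity)
      rw [le_div_iff₀ hτ'] at this
      rw [hk]; push_cast; linarith
    have hfrac : (τ : ℝ) / n ≤ 1 := by
      rw [div_le_one hn']; exact_mod_cast hτn
    have hexp : (1 - (τ : ℝ) / n) ^ k ≤ 1 / τ := by
      calc (1 - (τ : ℝ) / n) ^ k ≤ (Real.exp (-(τ / n))) ^ k := by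
            refine pow_le_pow_left₀ (by linarith) ?_ k
            have := Real.add_one_le_exp (-((τ : ℝ) / n))
            linarith
        _ = Real.exp (-(k * τ / n)) := by rw [← Real.exp_nat_mul]; congr 1; ring
        _ ≤ Real.exp (-l) := by
            refine Real.exp_le_exp.2 (neg_le_neg ?_)
            rw [le_div_iff₀ hn']; linarith
        _ ≤ 1 / τ := by
            rw [Real.exp_neg, ← one_div]
            refine one_div_le_one_div_of_le hτ' ?_
            calc (τ : ℝ) ≤ 2 ^ l := by exact_mod_cast hl
              _ ≤ Real.exp 1 ^ l := by
                refine pow_le_pow_left₀ (by norm_num) ?_ l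
                have := Real.add_one_le_exp (1 : ℝ)
                linarith
              _ = Real.exp l := by rw [← Real.exp_nat_mul, mul_one]
    have hUτ : (U.card : ℝ) * τ ≤ n := by
      calc (U.card : ℝ) * τ ≤ n * (1 / τ) * τ := by gcongr; exact hU.trans (by gcongr)
        _ = n := by field_simp
    have hl1 : (1 : ℝ) ≤ l := by exact_mod_cast hl0
    have hτn' : (τ : ℝ) ≤ n := by exact_mod_cast hτn
    have hDc : (D.card : ℝ) ≤ k := by exact_mod_cast hD
    have hun : ((D ∪ U).card : ℝ) ≤ D.card + U.card := by exact_mod_cast Finset.card_union_le D U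
    have : ((D ∪ U).card : ℝ) * τ ≤ 3 * n * l := by
      calc ((D ∪ U).card : ℝ) * τ ≤ (k + U.card) * τ := by gcongr; linarith
        _ = k * τ + U.card * τ := by ring
        _ ≤ (n * l + n) + n := by linarith
        _ ≤ 3 * n * l := by nlinarith
    exact_mod_cast this

end Counting

end DistLabel

namespace DistLabel

open WordRAM

/-! ## Choice of the parameters and sizes -/

/-- Parameters for graphs on `n` vertices and degree threshold `s + 1`. -/
def schemeParams (n s : ℕ) : Params where
  w := wordSize 32 n
  lam := Nat.log 2 (s + 1) + 1
  -- Small enough that the table has about n ^ (1/4) words up to a factor polynomial in s + 1, and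
  -- large enough that the chunk records amount to O(e) bits per block.
  g := (Nat.log 2 n + 1) / (4 * (2 * (Nat.log 2 (s + 1) + 1) + 4)) + 1
  N := 2 * n / 2 ^ (Nat.log 2 (s + 1) + 1) + 1
  K := n

section Sizes

variable {n s : ℕ}

theorem lt_B : s + 1 < (schemeParams n s).B := Nat.lt_pow_succ_log_self (by omega) _

theorem B_le : (schemeParams n s).B ≤ 2 * (s + 1) := by
  have := Nat.pow_log_le_self 2 (show s + 1 ≠ 0 by omega)
  show 2 ^ (Nat.log 2 (s + 1) + 1) ≤ _
  rw [pow_succ]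
  omega

theorem one_le_lam : 1 ≤ (schemeParams n s).lam := Nat.le_add_left _ _

theorem succ_le_two_pow (s : ℕ) : s + 1 ≤ 2 ^ s := Nat.lt_two_pow_self

theorem log_add_one_le (L : ℕ) : L + 1 ≤ 2 * 2 ^ (L / 2) := by
  have := succ_le_two_pow (L / 2)
  omega

theorem two_pow_log_le (hn : 1 ≤ n) : 2 ^ Nat.log 2 n ≤ n := Nat.pow_log_le_self 2 (by omega)

theorem lt_two_pow_log (n : ℕ) : n < 2 ^ (Nat.log 2 n + 1) := Nat.lt_pow_succ_log_self (by omega) n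

theorem two_pow_e_le : 2 ^ (schemeParams n s).e ≤ 64 * 2 ^ (2 * s) := by
  have h1 := (B_le (n := n) (s := s)).trans (Nat.mul_le_mul_left 2 (succ_le_two_pow s))
  rw [Content.two_pow_e]
  calc _ ≤ 4 * (2 * 2 ^ s) * (4 * (2 * 2 ^ s)) := by gcongr
    _ = 64 * 2 ^ (2 * s) := by rw [two_mul s, pow_add]; ring

theorem e_mul_g_le :
    (schemeParams n s).e * (schemeParams n s).g ≤ (Nat.log 2 n + 1) / 4 + (schemeParams n s).e := by
  have hg : (schemeParams n s).g = (Nat.log 2 n + 1) / 4 / (schemeParams n s).e + 1 := by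
    rw [Nat.div_div_eq_div_mul]; rfl
  rw [hg, mul_add, mul_one]
  gcongr
  exact Nat.mul_div_le _ _

theorem mul_succ_le (hn : 1 ≤ n) (hs : 16 * s ≤ Nat.log 2 n) :
    (Nat.log 2 n + 1) * (s + 1) ≤ 2 * n := by
  calc (Nat.log 2 n + 1) * (s + 1) ≤ (2 * 2 ^ (Nat.log 2 n / 2)) * 2 ^ s :=
        Nat.mul_le_mul (log_add_one_le _) (succ_le_two_pow s)
    _ = 2 * 2 ^ (Nat.log 2 n / 2 + s) := by rw [pow_add]; ring
    _ ≤ 2 * 2 ^ Nat.log 2 n := by gcongr <;> omega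
    _ ≤ 2 * n := by gcongr; exact two_pow_log_le hn

/-- With L = `Nat.log 2 n`, the exponents are L/4 for the table, L/2 for the word length and 3s ≤
3L/16 for the rest, together at most L. -/
theorem tab_mul_le (hn : 1 ≤ n) (hs : 16 * s ≤ Nat.log 2 n) :
    (schemeParams n s).tab * ((Nat.log 2 n + 1) * (s + 1)) ≤ 256 * n := by
  have h1 : (schemeParams n s).tab ≤ 2 ^ (Nat.log 2 n / 4 + 1) * (64 * 2 ^ (2 * s)) := by
    calc (schemeParams n s).tab ≤ 2 ^ ((Nat.log 2 n / 4 + 1) + (schemeParams n s).e) := by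
          refine Nat.pow_le_pow_right (by omega) (e_mul_g_le.trans ?_)
          omega
      _ ≤ _ := by rw [pow_add]; gcongr; exact two_pow_e_le
  calc _ ≤ (2 ^ (Nat.log 2 n / 4 + 1) * (64 * 2 ^ (2 * s))) *
        ((2 * 2 ^ (Nat.log 2 n / 2)) * 2 ^ s) := by
        gcongr
        exacts [log_add_one_le _, succ_le_two_pow s]
    _ = 256 * 2 ^ (Nat.log 2 n / 4 + Nat.log 2 n / 2 + 3 * s) := by
        rw [show 3 * s = 2 * s + s by ring]; simp only [pow_add]; ring
    _ ≤ 256 * 2 ^ Nat.log 2 n := by gcongr <;> omega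
    _ ≤ 256 * n := by gcongr; exact two_pow_log_le hn

/-- The exponent L/2 + 6s is at most 7L/8, where L = `Nat.log 2 n`. -/
theorem items_mul_le (hn : 1 ≤ n) (hs : 16 * s ≤ Nat.log 2 n) {m : ℕ} (hm : m ≤ 2 ^ (5 * (s + 1))) :
    m * ((Nat.log 2 n + 1) * (s + 1)) ≤ 64 * n := by
  calc _ ≤ 2 ^ (5 * (s + 1)) * ((2 * 2 ^ (Nat.log 2 n / 2)) * 2 ^ s) := by
        gcongr
        exacts [log_add_one_le _, succ_le_two_pow s]
    _ = 64 * 2 ^ (Nat.log 2 n / 2 + 6 * s) := by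
        rw [show 6 * s = 5 * s + s by ring, mul_add]; simp only [pow_add]; ring
    _ ≤ 64 * 2 ^ Nat.log 2 n := by gcongr <;> omega
    _ ≤ 64 * n := by gcongr; exact two_pow_log_le hn

theorem succ_le_of_log (hn : 1 ≤ n) (hs : 16 * s ≤ Nat.log 2 n) : s + 1 ≤ n :=
  (succ_le_two_pow s).trans ((Nat.pow_le_pow_right (by omega) (by omega)).trans (two_pow_log_le hn))

theorem N_mul_le (hn : 1 ≤ n) (hs : 16 * s ≤ Nat.log 2 n) :
    (schemeParams n s).N * (s + 1) ≤ 3 * n := by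
  have h1 : (schemeParams n s).N = 2 * n / (schemeParams n s).B + 1 := rfl
  have h2 : 2 * n / (schemeParams n s).B * (s + 1) ≤ 2 * n :=
    (Nat.mul_le_mul_left _ lt_B.le).trans (Nat.div_mul_le_self _ _)
  have := succ_le_of_log hn hs
  rw [h1, add_mul]
  omega

theorem e_le : (schemeParams n s).e ≤ 6 * (schemeParams n s).lam := by
  have := one_le_lam (n := n) (s := s)
  unfold Params.e
  omega

/-- One record serves `g` blocks, and 4eg is at least log n + 1; so the word length cancels and a
factor `e` remains. -/
theorem chunks_mul_le (hn : 1 ≤ n) (hs : 16 * s ≤ Nat.log 2 n) :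
    (schemeParams n s).NC * ((Nat.log 2 n + 1) * (s + 1)) ≤
      72 * (n * (schemeParams n s).lam) + 2 * n := by
  set p := schemeParams n s with hp
  have he : 0 < 4 * p.e := by unfold Params.e; omega
  have h1 : Nat.log 2 n + 1 ≤ 4 * p.e * p.g := by
    have hg : p.g = (Nat.log 2 n + 1) / (4 * p.e) + 1 := rfl
    have := Nat.lt_mul_div_succ (Nat.log 2 n + 1) he
    rw [hg]
    exact this.le
  have h2 : p.N / p.g * (Nat.log 2 n + 1) ≤ 4 * p.e * p.N := by
    calc _ ≤ p.N / p.g * (4 * p.e * p.g) := Nat.mul_le_mul_left _ h1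
      _ = 4 * p.e * (p.N / p.g * p.g) := by ring
      _ ≤ 4 * p.e * p.N := Nat.mul_le_mul_left _ (Nat.div_mul_le_self _ _)
  calc p.NC * ((Nat.log 2 n + 1) * (s + 1))
      = (p.N / p.g * (Nat.log 2 n + 1)) * (s + 1) + (Nat.log 2 n + 1) * (s + 1) := by
        unfold Params.NC; ring
    _ ≤ (4 * p.e * p.N) * (s + 1) + 2 * n :=
        Nat.add_le_add (Nat.mul_le_mul_right _ h2) (mul_succ_le hn hs)
    _ = 4 * p.e * (p.N * (s + 1)) + 2 * n := by ring
    _ ≤ 4 * (6 * p.lam) * (3 * n) + 2 * n :=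
        Nat.add_le_add_right (Nat.mul_le_mul (Nat.mul_le_mul_left _ e_le) (N_mul_le hn hs)) _
    _ = _ := by ring

/-- Only the entries need the square of `lam`: there are O(n · lam / (s + 1)) of them with O(lam)
bits each. The words contribute at most 32 · 890 and the entries 144 to the constant. -/
theorem length_label_mul_le (hn : 1 ≤ n) (hs : 16 * s ≤ Nat.log 2 n) {d : Content}
    (hP : d.P.card * (s + 1) ≤ 21 * (n * (schemeParams n s).lam))
    (hm : d.items.length ≤ 2 ^ (5 * (s + 1))) :
    (d.nW (schemeParams n s) * (schemeParams n s).w +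
      (d.entries (schemeParams n s)).length * (schemeParams n s).e) * (s + 1) ≤
      40000 * (n * (schemeParams n s).lam ^ 2) := by
  have hE := Content.length_entries_le (d := d) (p := schemeParams n s)
  have h1 := mul_succ_le hn hs
  have h2 := tab_mul_le hn hs
  have h3 := items_mul_le hn hs hm
  have h4 := chunks_mul_le hn hs
  have h5 := N_mul_le hn hs
  have h6 := e_le (n := n) (s := s)
  have h7 := one_le_lam (n := n) (s := s)
  have hw : (schemeParams n s).w = 32 * (Nat.log 2 n + 1) := rfl
  set p := schemeParams n s
  set Q := (Nat.log 2 n + 1) * (s + 1) with hQ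
  have e1 : d.nW p * p.w * (s + 1) =
      32 * (9 * Q + p.tab * Q + 4 * (p.NC * Q) + 5 * (d.items.length * Q)) := by
    unfold Content.nW Params.listStart; rw [hw, hQ]; ring
  have hnl : n ≤ n * p.lam := Nat.le_mul_of_pos_right _ h7
  have hnl2 : n * p.lam ≤ n * p.lam ^ 2 := Nat.mul_le_mul_left _ (Nat.le_self_pow (by omega) _)
  have e2 : (d.entries p).length * p.e * (s + 1) ≤ 144 * (n * p.lam ^ 2) := by
    calc (d.entries p).length * p.e * (s + 1)
        ≤ (d.P.card + p.N) * (6 * p.lam) * (s + 1) := by gcongr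
      _ = (d.P.card * (s + 1) + p.N * (s + 1)) * (6 * p.lam) := by ring
      _ ≤ (21 * (n * p.lam) + 3 * (n * p.lam)) * (6 * p.lam) :=
        Nat.mul_le_mul_right _ (by omega)
      _ = _ := by ring
  rw [add_mul, e1]
  omega

/-- Validity of the contents for the chosen parameters. -/
theorem valid_content (hn : 1 ≤ n) (hs : 16 * s ≤ Nat.log 2 n) {d : Content}
    (hP : d.P.card * (s + 1) ≤ 21 * (n * (schemeParams n s).lam))
    (hm : d.items.length ≤ 2 ^ (5 * (s + 1)))
    (hlip : ∀ i, d.η (i + 1) ≤ d.η i + 1 ∧ d.η i ≤ d.η (i + 1) + 1) (hη : ∀ i, d.η i ≤ n)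
    (hcomp : d.comp < n) (hitems : ∀ i ∈ d.items, i.1 < 2 * n ∧ i.2 ≤ n) :
    d.Valid (schemeParams n s) := by
  have hlen := length_label_mul_le hn hs hP hm
  have hB := B_le (n := n) (s := s)
  have he2 := two_pow_e_le (n := n) (s := s)
  have he := e_le (n := n) (s := s)
  have heg := e_mul_g_le (n := n) (s := s)
  have hsn := succ_le_of_log hn hs
  have hlam : (schemeParams n s).lam ≤ n := by
    have := Nat.log_lt_self 2 (show s + 1 ≠ 0 by omega)
    exact (show Nat.log 2 (s + 1) + 1 ≤ s + 1 by omega).trans hsn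
  have hlamL : (schemeParams n s).lam ≤ Nat.log 2 n + 1 :=
    Nat.add_le_add_right (Nat.log_mono_right hsn) 1
  have hNdef : (schemeParams n s).N = 2 * n / (schemeParams n s).B + 1 := rfl
  have hBpos := Content.B_pos (p := schemeParams n s)
  have hw : (schemeParams n s).w = 32 * (Nat.log 2 n + 1) := rfl
  have hK : (schemeParams n s).K = n := rfl
  have hg0 : 0 < (schemeParams n s).g := Nat.succ_pos _
  set p := schemeParams n s
  have hY : n < 2 ^ (Nat.log 2 n + 1) := lt_two_pow_log n
  have hY2 : 2 ≤ 2 ^ (Nat.log 2 n + 1) := by rw [pow_succ]; have := Nat.one_le_two_pow (n := Nat.log 2 n); omega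
  set Y := 2 ^ (Nat.log 2 n + 1) with hYdef
  have hYw : 2 ^ p.w = Y ^ 32 := by rw [hw, mul_comm, pow_mul]
  have hY16 : 65536 ≤ Y ^ 16 := by
    calc 65536 = 2 ^ 16 := by norm_num
      _ ≤ Y ^ 16 := Nat.pow_le_pow_left hY2 16
  -- All quantities to be bounded are at most cubic in n, while `2 ^ w` is `Y ^ 32` with `Y` above n
  -- and at least 2.
  have hbig : ∀ a : ℕ, a ≤ 65536 * n ^ 3 → a < 2 ^ p.w := fun a ha => by
    calc a ≤ 65536 * n ^ 3 := ha
      _ ≤ Y ^ 16 * Y ^ 3 := by gcongr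
      _ < Y ^ 32 := by rw [← pow_add]; exact Nat.pow_lt_pow_right (by omega) (by omega)
      _ = 2 ^ p.w := hYw.symm
  have hn3 : n ≤ n ^ 3 := Nat.le_self_pow (by omega) n
  have hn2 : n ^ 2 ≤ n ^ 3 := Nat.pow_le_pow_right hn (by omega)
  refine ⟨hg0, by omega, hlip, hη, hbig _ ?_, hbig _ (by omega), hbig _ ?_, fun i hi => ?_⟩
  · calc _ ≤ _ := Nat.le_mul_of_pos_right _ (Nat.succ_pos s)
      _ ≤ 40000 * (n * p.lam ^ 2) := hlen
      _ ≤ 65536 * (n * n ^ 2) := by gcongr; omega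
      _ = 65536 * n ^ 3 := by ring
  · have h1 : p.B * (p.N + 1) ≤ 6 * n := by
      have := Nat.mul_div_le (2 * n) p.B
      rw [hNdef, mul_add, mul_add]
      omega
    have h2 : 2 ^ (2 * s) ≤ n := by
      exact (Nat.pow_le_pow_right (by omega) (by omega)).trans (two_pow_log_le hn)
    omega
  · refine ⟨(hitems i hi).1.trans ?_, (hitems i hi).2⟩
    have := Nat.lt_mul_div_succ (2 * n) hBpos
    rwa [hNdef, Nat.mul_comm _ p.B]

end Sizes

end DistLabel

namespace DistLabel

open WordRAM

/-! ## Label contents of a graph -/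

section Labels

variable {n : ℕ} (G : SimpleGraph (Fin n)) (cost : Sym2 (Fin n) → ℕ)

/-- The representative of a component. -/
noncomputable def root (u : Fin n) : Fin n := (G.connectedComponentMk u).out

theorem reachable_root (u : Fin n) : G.Reachable (root G u) u :=
  SimpleGraph.ConnectedComponent.exact (Quot.out_eq (G.connectedComponentMk u))

theorem root_eq {u v : Fin n} (h : G.Reachable u v) : root G u = root G v := by
  rw [root, root, SimpleGraph.ConnectedComponent.sound h]

theorem reachable_of_root_eq {u v : Fin n} (h : root G u = root G v) : G.Reachable u v :=
  (reachable_root G u).symm.trans (h ▸ reachable_root G v)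

/-- A tour of the component of `r`. -/
noncomputable def tour (r : Fin n) : ℕ → Fin n := (exists_tour (G := G) r).choose

theorem tour_step (r : Fin n) (i : ℕ) :
    tour G r i = tour G r (i + 1) ∨ G.Adj (tour G r i) (tour G r (i + 1)) :=
  (exists_tour (G := G) r).choose_spec.1 i

theorem reachable_tour (r : Fin n) (i : ℕ) : G.Reachable r (tour G r i) :=
  (exists_tour (G := G) r).choose_spec.2.1 i

theorem exists_tourIdx (r v : Fin n) :
    ∃ i, G.Reachable r v → i < 2 * n ∧ tour G r i = v := by
  by_cases h : G.Reachable r v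
  · obtain ⟨i, hi, hv⟩ := (exists_tour (G := G) r).choose_spec.2.2 v h
    rw [Fintype.card_fin] at hi
    exact ⟨i, fun _ => ⟨hi, hv⟩⟩
  · exact ⟨0, fun h' => absurd h' h⟩

/-- A position of `v` on the tour. -/
noncomputable def tourIdx (r v : Fin n) : ℕ := (exists_tourIdx G r v).choose

theorem tourIdx_spec {r v : Fin n} (h : G.Reachable r v) :
    tourIdx G r v < 2 * n ∧ tour G r (tourIdx G r v) = v :=
  (exists_tourIdx G r v).choose_spec h

open Classical in
/-- The content of the label of `u` for given sets of hubs and own hubs. -/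
noncomputable def content (H O : Fin n → Set (Fin n)) (u : Fin n) : Content where
  comp := root G u
  η i := natDist G cost u (tour G (root G u) i)
  P := (Finset.univ.filter fun w => w ∈ H u ∧ G.Reachable u w).image (tourIdx G (root G u))
  items := (Finset.univ.filter fun w => w ∈ O u ∧ G.Reachable u w).toList.map fun w =>
    (tourIdx G (root G u) w, natDist G cost u w)

variable {G cost} {H O : Fin n → Set (Fin n)}

theorem card_content_P_le (u : Fin n) : (content G cost H O u).P.card ≤ (H u).ncard := by
  classical
  refine Finset.card_image_le.trans ?_
  rw [Set.ncard_eq_toFinset_card']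
  exact Finset.card_le_card fun w hw => by simpa using (Finset.mem_filter.1 hw).2.1

theorem length_content_items_le (u : Fin n) :
    (content G cost H O u).items.length ≤ (O u).ncard := by
  classical
  rw [content, List.length_map, Finset.length_toList, Set.ncard_eq_toFinset_card']
  exact Finset.card_le_card fun w hw => by simpa using (Finset.mem_filter.1 hw).2.1

theorem mem_content_items {u : Fin n} {i : ℕ × ℕ} :
    i ∈ (content G cost H O u).items ↔
      ∃ w, w ∈ O u ∧ G.Reachable u w ∧ i = (tourIdx G (root G u) w, natDist G cost u w) := by
  simp only [content, List.mem_map, Finset.mem_toList, Finset.mem_filter, Finset.mem_univ, true_and,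
    and_assoc]
  exact exists_congr fun w => and_congr_right fun _ => and_congr_right fun _ => eq_comm

/-- `tour` is a left inverse of `tourIdx` on the component, so distinct vertices have distinct
positions. -/
theorem mem_content_P {u w : Fin n} (h : G.Reachable u w) :
    tourIdx G (root G u) w ∈ (content G cost H O u).P ↔ w ∈ H u := by
  classical
  simp only [content, Finset.mem_image, Finset.mem_filter, Finset.mem_univ, true_and]
  constructor
  · rintro ⟨w', ⟨hw', hr⟩, he⟩
    rw [← (tourIdx_spec G ((reachable_root G u).trans h)).2, ← he,
      (tourIdx_spec G ((reachable_root G u).trans hr)).2]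
    exact hw'
  · exact fun hw => ⟨w, ⟨hw, h⟩, rfl⟩

theorem content_η {u w : Fin n} (h : G.Reachable u w) :
    (content G cost H O u).η (tourIdx G (root G u) w) = natDist G cost u w := by
  simp only [content]
  rw [(tourIdx_spec G ((reachable_root G u).trans h)).2]

theorem valid_content_graph (hc : ∀ e ∈ G.edgeSet, cost e ≤ 1) {s : ℕ}
    (hs : 16 * s ≤ Nat.log 2 n) (u : Fin n)
    (hH : (H u).ncard * (s + 1) ≤ 21 * (n * (schemeParams n s).lam))
    (hO : (O u).ncard ≤ 2 ^ (5 * (s + 1))) :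
    (content G cost H O u).Valid (schemeParams n s) := by
  have hreach : ∀ i, G.Reachable u (tour G (root G u) i) := fun i =>
    (reachable_root G u).symm.trans (reachable_tour G _ i)
  have hle : ∀ w, natDist G cost u w ≤ n := fun w => by
    simpa using natDist_le_card hc u w
  refine valid_content (Nat.one_le_iff_ne_zero.2 fun h => ?_) hs
    ((Nat.mul_le_mul_right _ (card_content_P_le u)).trans hH)
    ((length_content_items_le u).trans hO) (fun i => ⟨?_, ?_⟩) (fun i => hle _) (root G u).isLt ?_
  · subst h; exact u.elim0
  · exact natDist_le_add_one hc (hreach i) (tour_step G _ i)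
  · exact natDist_le_add_one hc (hreach (i + 1)) ((tour_step G _ i).imp Eq.symm fun h => h.symm)
  · intro i hi
    obtain ⟨w, -, hr, rfl⟩ := mem_content_items.1 hi
    exact ⟨(tourIdx_spec G ((reachable_root G u).trans hr)).1, hle w⟩

/-- The decoder finds the best common hub. -/
theorem decode_content {p : Params} (hv : ∀ u, (content G cost H O u).Valid p) {u v : Fin n}
    (h : G.Reachable u v) (hex : ∃ w ∈ O v, w ∈ H u) (hO : ∀ w ∈ O v, G.Reachable v w) :
    ∃ w ∈ O v, w ∈ H u ∧
      (∀ w' ∈ O v, w' ∈ H u →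
        delta G cost u w + delta G cost w v ≤ delta G cost u w' + delta G cost w' v) ∧
      OutputsWithin p.w decoder ((content G cost H O u).label p) ((content G cost H O v).label p)
        ((O v).ncard * (41 + 4 * p.B) + 20) (delta G cost u w + delta G cost w v) := by
  have hroot := root_eq G h
  have hmem : ∀ w ∈ O v, w ∈ H u →
      (tourIdx G (root G v) w, natDist G cost v w) ∈ (content G cost H O v).items ∧
        tourIdx G (root G v) w ∈ (content G cost H O u).P := fun w hw hwu =>
    ⟨mem_content_items.2 ⟨w, hw, hO w hw, rfl⟩, by
      rw [← hroot]; exact (mem_content_P (h.trans (hO w hw))).2 hwu⟩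
  have hval : ∀ w ∈ O v, (((content G cost H O u).η (tourIdx G (root G v) w) +
      natDist G cost v w : ℕ) : ℕ∞) = delta G cost u w + delta G cost w v := fun w hw => by
    rw [← hroot, content_η (h.trans (hO w hw)), Nat.cast_add, coe_natDist (h.trans (hO w hw)),
      coe_natDist (hO w hw), delta_comm v w]
  obtain ⟨i, hi, hiP, hmin, hout⟩ := (hv u).decode_eq (hv v)
    (show ((root G u : Fin n) : ℕ) = root G v by rw [hroot]) (by
      obtain ⟨w, hw, hwu⟩ := hex
      exact ⟨_, (hmem w hw hwu).1, (hmem w hw hwu).2⟩)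
  obtain ⟨w, hw, hr, rfl⟩ := mem_content_items.1 hi
  refine ⟨w, hw, ?_, fun w' hw' hwu' => ?_, ?_⟩
  · rw [← hroot] at hiP
    exact (mem_content_P (h.trans hr)).1 hiP
  · rw [← hval w hw, ← hval w' hw', Nat.cast_le]
    exact hmin _ (hmem w' hw' hwu').1 (hmem w' hw' hwu').2
  · rw [← hval w hw]
    obtain ⟨k, s, hk, hx⟩ := hout
    exact ⟨k, s, hk.trans (Nat.add_le_add_right
      (Nat.mul_le_mul_right _ (length_content_items_le v)) _), hx⟩

end Labels

/-! ## Bounds in terms of `lg` -/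

theorem one_le_lg (x : ℝ) : 1 ≤ lg x := le_max_left _ _

theorem log_le_lg {m : ℕ} (hm : 1 ≤ m) : (Nat.log 2 m : ℝ) ≤ lg m := by
  refine le_trans ?_ (le_max_right _ _)
  rw [Real.le_logb_iff_rpow_le (by norm_num) (by exact_mod_cast hm), Real.rpow_natCast]
  exact_mod_cast Nat.pow_log_le_self 2 (by omega)

theorem lg_le_log (m : ℕ) : lg m ≤ Nat.log 2 m + 1 := by
  refine max_le (by simp) ?_
  rcases Nat.eq_zero_or_pos m with rfl | hm
  · simp
  · rw [Real.logb_le_iff_le_rpow (by norm_num) (by exact_mod_cast hm)]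
    have := (Nat.lt_pow_succ_log_self (b := 2) (by omega) m).le
    have h : ((m : ℕ) : ℝ) ≤ ((2 ^ (Nat.log 2 m).succ : ℕ) : ℝ) := by exact_mod_cast this
    rw [Nat.cast_pow, ← Real.rpow_natCast, Nat.cast_succ] at h
    exact_mod_cast h

theorem one_le_radius {τ : ℕ} (hτ : 1 ≤ τ) : 1 ≤ radius τ := by
  refine Nat.le_floor ?_
  rw [Nat.cast_one, le_div_iff₀ (one_pos.trans_le (one_le_lg _)), one_mul]
  refine (lg_le_log τ).trans ?_
  have := Nat.log_lt_self 2 (show τ ≠ 0 by omega)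
  exact_mod_cast this

theorem radius_mul_lg_le (τ : ℕ) : (radius τ : ℝ) * lg τ ≤ τ := by
  have h := one_pos.trans_le (one_le_lg (τ : ℝ))
  rw [← le_div_iff₀ h]
  exact Nat.floor_le (by positivity)

/-- Keeps τ ^ R, and with it the restricted balls, at 2 ^ O(τ). -/
theorem radius_mul_log_le {τ : ℕ} (hτ : 1 ≤ τ) : radius τ * (Nat.log 2 τ + 1) ≤ 2 * τ := by
  have h := radius_mul_lg_le τ
  have h1 := one_le_lg (τ : ℝ)
  have h2 := log_le_lg hτ
  have h3 : (radius τ : ℝ) * (Nat.log 2 τ + 1) ≤ 2 * τ := by nlinarith [(radius τ).cast_nonneg (α := ℝ)]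
  exact_mod_cast h3

/-- The converse estimate, which turns n / R into O(n log τ / τ). -/
theorem le_radius_mul {τ : ℕ} (hτ : 1 ≤ τ) : τ ≤ 2 * (Nat.log 2 τ + 1) * radius τ := by
  have hlg := one_pos.trans_le (one_le_lg (τ : ℝ))
  have h1 : (τ : ℝ) / lg τ < radius τ + 1 := Nat.lt_floor_add_one _
  rw [div_lt_iff₀ hlg] at h1
  have h2 : (1 : ℝ) ≤ radius τ := by exact_mod_cast one_le_radius hτ
  have h3 := lg_le_log τ
  have h4 : (τ : ℝ) ≤ 2 * (Nat.log 2 τ + 1) * radius τ := by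
    calc (τ : ℝ) ≤ (radius τ + 1) * lg τ := h1.le
      _ ≤ (radius τ + radius τ) * (Nat.log 2 τ + 1) := by gcongr
      _ = _ := by ring
  exact_mod_cast h4

/-! ### Sizes of the hub sets -/

section Hubs

variable {n s : ℕ} {G : SimpleGraph (Fin n)} {cost : Sym2 (Fin n) → ℕ}

theorem ncard_lowBall_le_two_pow (u : Fin n) :
    (lowBall G (s + 1) (radius (s + 1)) u).ncard ≤ 2 ^ (3 * (s + 1)) := by
  have h1 := radius_mul_log_le (τ := s + 1) (by omega)
  have h2 : radius (s + 1) ≤ s + 1 := by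
    have h := radius_mul_lg_le (s + 1)
    have h' := one_le_lg ((s + 1 : ℕ) : ℝ)
    have : (radius (s + 1) : ℝ) ≤ (s + 1 : ℕ) := by
      nlinarith [(radius (s + 1)).cast_nonneg (α := ℝ)]
    exact_mod_cast this
  calc _ ≤ (radius (s + 1) + 1) * (s + 1) ^ radius (s + 1) := ncard_lowBall_le (by omega) _ _
    _ ≤ 2 ^ (s + 1) * (2 ^ (Nat.log 2 (s + 1) + 1)) ^ radius (s + 1) := by
      gcongr
      · exact (Nat.add_le_add_right h2 1).trans (succ_le_two_pow (s + 1))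
      · exact (lt_two_pow_log (s + 1)).le
    _ = 2 ^ (s + 1 + (Nat.log 2 (s + 1) + 1) * radius (s + 1)) := by rw [← pow_mul, ← pow_add]
    _ ≤ 2 ^ (3 * (s + 1)) := Nat.pow_le_pow_right (by omega) (by rw [Nat.mul_comm]; omega)

theorem ncard_ownHubs_le_two_pow (f : Fin n → Fin n) (v : Fin n) :
    (ownHubs G (s + 1) (radius (s + 1)) f v).ncard ≤ 2 ^ (5 * (s + 1)) := by
  have h := ncard_lowBall_le_two_pow (G := G) (s := s) v
  have h1 : 1 ≤ 2 ^ (4 * (s + 1)) := Nat.one_le_two_pow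
  calc _ ≤ (s + 1 + 1) * (lowBall G (s + 1) (radius (s + 1)) v).ncard + 1 := ncard_ownHubs_le _ _ _
    _ ≤ 2 ^ (s + 1) * 2 ^ (3 * (s + 1)) + 1 :=
      Nat.add_le_add_right (Nat.mul_le_mul (succ_le_two_pow (s + 1)) h) 1
    _ = 2 ^ (4 * (s + 1)) + 1 := by rw [← pow_add]; ring_nf
    _ ≤ 2 ^ (4 * (s + 1)) * 2 := by omega
    _ = 2 ^ (4 * (s + 1) + 1) := (pow_succ _ _).symm
    _ ≤ 2 ^ (5 * (s + 1)) := Nat.pow_le_pow_right (by omega) (by omega)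

/-- Ball, layer class and dominators contribute 16n, 2nl and 3nl; the ball is negligible because 2 ^
(4s) ≤ n. -/
theorem ncard_hubs_mul_le (hn : 1 ≤ n) (hs : 16 * s ≤ Nat.log 2 n) {D : Finset (Fin n)}
    (hD : D.card * (s + 1) ≤ 3 * n * (Nat.log 2 (s + 1) + 1)) {offset : Fin n → ℕ} (u : Fin n)
    (hL : (layer G cost (radius (s + 1)) (offset u) u).ncard * radius (s + 1) ≤ n) :
    (hubs G cost (s + 1) D offset u).ncard * (s + 1) ≤ 21 * (n * (Nat.log 2 (s + 1) + 1)) := by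
  set l := Nat.log 2 (s + 1) + 1 with hl
  have h1 : (lowBall G (s + 1) (radius (s + 1)) u).ncard * (s + 1) ≤ 16 * n := by
    calc _ ≤ 2 ^ (3 * (s + 1)) * 2 ^ (s + 1) :=
          Nat.mul_le_mul (ncard_lowBall_le_two_pow u) Nat.lt_two_pow_self.le
      _ = 16 * 2 ^ (4 * s) := by rw [← pow_add]; ring_nf
      _ ≤ 16 * 2 ^ Nat.log 2 n := by gcongr <;> omega
      _ ≤ 16 * n := by gcongr; exact two_pow_log_le hn
  have h2 : (layer G cost (radius (s + 1)) (offset u) u).ncard * (s + 1) ≤ 2 * (n * l) := by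
    calc _ ≤ (layer G cost (radius (s + 1)) (offset u) u).ncard * (2 * l * radius (s + 1)) :=
          Nat.mul_le_mul_left _ (le_radius_mul (by omega))
      _ = 2 * l * ((layer G cost (radius (s + 1)) (offset u) u).ncard * radius (s + 1)) := by ring
      _ ≤ 2 * l * n := Nat.mul_le_mul_left _ hL
      _ = 2 * (n * l) := by ring
  have h3 : (hubs G cost (s + 1) D offset u).ncard ≤
      (lowBall G (s + 1) (radius (s + 1)) u).ncard +
        (layer G cost (radius (s + 1)) (offset u) u).ncard + D.card := by
    refine (Set.ncard_union_le _ _).trans ?_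
    rw [Set.ncard_coe_finset]
    exact Nat.add_le_add_right (Set.ncard_union_le _ _) _
  have h4 : n ≤ n * l := Nat.le_mul_of_pos_right _ (by omega)
  rw [mul_assoc] at hD
  calc _ ≤ ((lowBall G (s + 1) (radius (s + 1)) u).ncard +
        (layer G cost (radius (s + 1)) (offset u) u).ncard + D.card) * (s + 1) :=
        Nat.mul_le_mul_right _ h3
    _ ≤ _ := by rw [add_mul, add_mul]; omega

end Hubs

/-- The degree threshold and `lg T` are of the same order. -/
theorem threshold_bounds {T : ℕ} (hT : 1 ≤ T) :
    ((Nat.log 2 T / 16 + 1 : ℕ) : ℝ) ≤ 2 * lg T ∧ lg T ≤ 16 * (Nat.log 2 T / 16 + 1 : ℕ) := by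
  have h1 := one_le_lg (T : ℝ)
  have h2 := log_le_lg hT
  have h3 := lg_le_log T
  constructor
  · have : ((Nat.log 2 T / 16 + 1 : ℕ) : ℝ) ≤ Nat.log 2 T + 1 := by
      exact_mod_cast Nat.add_le_add_right (Nat.div_le_self _ _) 1
    linarith
  · have : ((Nat.log 2 T + 1 : ℕ) : ℝ) ≤ ((16 * (Nat.log 2 T / 16 + 1) : ℕ) : ℝ) :=
      Nat.cast_le.2 (by omega)
    push_cast at this ⊢
    linarith

/-- The threshold is at most 2 `lg T`, so its logarithm is at most 1 + `lg (lg T)`; the constants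
are absorbed since `lg` is at least 1. -/
theorem log_threshold_le {T : ℕ} (hT : 1 ≤ T) :
    ((Nat.log 2 (Nat.log 2 T / 16 + 1) + 1 : ℕ) : ℝ) ≤ 3 * lg (lg T) := by
  have h0 := one_le_lg (T : ℝ)
  have h1 := one_le_lg (lg T)
  have h2 := (threshold_bounds hT).1
  set τ := Nat.log 2 T / 16 + 1
  have h3 : (Nat.log 2 τ : ℝ) ≤ 1 + lg (lg T) := by
    have hle : ((2 : ℝ) ^ (Nat.log 2 τ)) ≤ 2 * lg T := by
      refine le_trans ?_ h2
      exact_mod_cast Nat.pow_log_le_self 2 (show τ ≠ 0 by omega)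
    rw [← Real.rpow_natCast, ← Real.le_logb_iff_rpow_le (by norm_num) (by linarith),
      Real.logb_mul (by norm_num) (by linarith), Real.logb_self_eq_one (by norm_num)] at hle
    exact hle.trans (by gcongr; exact le_max_right _ _)
  push_cast
  linarith

/-- Time bound for the decoder. -/
theorem time_le {n T m : ℕ} (hT : 1 ≤ T) (hm : m ≤ 2 ^ (5 * (Nat.log 2 T / 16 + 1))) :
    m * (41 + 4 * (schemeParams n (Nat.log 2 T / 16)).B) + 20 ≤ max (2 ^ 25) T := by
  set s := Nat.log 2 T / 16 with hs
  have hB := B_le (n := n) (s := s)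
  have h1 := succ_le_two_pow s
  have h2 : 2 ^ (16 * s) ≤ T :=
    (Nat.pow_le_pow_right (by omega) (by omega)).trans (Nat.pow_log_le_self 2 (by omega))
  have h3 : 1 ≤ 2 ^ (5 * (s + 1)) := Nat.one_le_two_pow
  have h4 : m * (41 + 4 * (schemeParams n s).B) + 20 ≤ 2208 * 2 ^ (6 * s) := by
    calc _ ≤ 2 ^ (5 * (s + 1)) * (41 + 4 * (2 * (s + 1))) + 2 ^ (5 * (s + 1)) * 20 := by
          gcongr; omega
      _ = 2 ^ (5 * (s + 1)) * (61 + 8 * (s + 1)) := by ring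
      _ ≤ 2 ^ (5 * (s + 1)) * (69 * 2 ^ s) := by gcongr; omega
      _ = 2208 * 2 ^ (6 * s) := by
          rw [show 6 * s = 5 * s + s by ring, mul_add, pow_add, pow_add]; ring
  -- For large `s` the gap between 2 ^ (6s) and 2 ^ (16s) ≤ T absorbs the constant; otherwise the
  -- time is below 2208² < 2 ^ 25.
  by_cases hc : 2208 ≤ 2 ^ (10 * s)
  · refine h4.trans (le_trans ?_ (le_max_right _ _))
    calc _ ≤ 2 ^ (10 * s) * 2 ^ (6 * s) := Nat.mul_le_mul_right _ hc
      _ = 2 ^ (16 * s) := by rw [← pow_add]; ring_nf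
      _ ≤ T := h2
  · have : 2 ^ (6 * s) ≤ 2 ^ (10 * s) := Nat.pow_le_pow_right (by omega) (by omega)
    exact h4.trans (le_trans (by omega) (le_max_left _ _))

end DistLabel

/-! ### Assembly of the labeling scheme -/

theorem theorem3 :
    ∃ (P : WordRAM.Prog) (κ C : ℕ), ∀ n T : ℕ, 1 ≤ T → T ≤ n →
      ∃ τ : ℕ, 1 ≤ τ ∧ (τ : ℝ) ≤ C * DistLabel.lg T ∧ DistLabel.lg T ≤ C * τ ∧
      ∀ (G : SimpleGraph (Fin n)) (cost : Sym2 (Fin n) → ℕ), (∀ e ∈ G.edgeSet, cost e ≤ 1) →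
        ∃ (label : Fin n → List Bool) (D : Set (Fin n)) (offset : Fin n → ℕ),
          -- size of the labels
          (∀ u, ((label u).length : ℝ) ≤
            C * (n * DistLabel.lg (DistLabel.lg T) ^ 2 / DistLabel.lg T)) ∧
          -- the hub sets
          DistLabel.Dominates G D (DistLabel.highDeg G τ) ∧
          (∀ u, offset u < DistLabel.radius τ ∧
            (DistLabel.layer G cost (DistLabel.radius τ) (offset u) u).ncard *
              DistLabel.radius τ ≤ n) ∧
          (∀ u, ((DistLabel.hubs G cost τ D offset u).ncard : ℝ) ≤
            C * (n * DistLabel.lg (DistLabel.lg T) / DistLabel.lg T)) ∧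
          -- decoding
          ∀ u v, ∃ d : ℕ∞,
            WordRAM.OutputsWithin (WordRAM.wordSize κ n) P (label u) (label v) (max C T) d ∧
            DistLabel.delta G cost u v ≤ d ∧ d ≤ DistLabel.delta G cost u v + 2 ∧
            (G.Reachable u v →
              ∃ w ∈ DistLabel.hubs G cost τ D offset u ∩ DistLabel.hubs G cost τ D offset v,
                d = DistLabel.delta G cost u w + DistLabel.delta G cost w v) := by
  open DistLabel in
  -- `2 ^ 25` exceeds both the factor 16 · 40000 · 9 of the label size and the time needed for small
  -- `T`.
  refine ⟨decoder, 32, 2 ^ 25, fun n T hT hTn => ?_⟩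
  have hn : 1 ≤ n := hT.trans hTn
  obtain ⟨hτ1, hτ2⟩ := threshold_bounds hT
  have hlam := log_threshold_le hT
  have hlg := one_le_lg (T : ℝ)
  have hlglg := one_le_lg (lg T)
  have hs : 16 * (Nat.log 2 T / 16) ≤ Nat.log 2 n :=
    (Nat.mul_div_le _ _).trans (Nat.log_mono_right hTn)
  have htime := fun m => time_le (n := n) (T := T) (m := m) hT
  set s := Nat.log 2 T / 16 with hsdef
  have hsn := succ_le_of_log hn hs
  have hτpos : (0 : ℝ) < (s + 1 : ℕ) := by positivity
  have hn' : (1 : ℝ) ≤ n := by exact_mod_cast hn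
  refine ⟨s + 1, by omega, hτ1.trans (by push_cast; linarith), hτ2.trans (by gcongr; norm_num),
    fun G cost hc => ?_⟩
  obtain ⟨D, hDdom, hDcard⟩ := exists_dominating (G := G) (τ := s + 1)
    (l := Nat.log 2 (s + 1) + 1) (by omega) (by simpa using hsn) (lt_two_pow_log _).le (by omega)
  rw [Fintype.card_fin] at hDcard
  choose offset hoff hlay using
    fun u => exists_offset (G := G) (cost := cost) (one_le_radius (τ := s + 1) (by omega)) u
  simp only [Fintype.card_fin] at hlay
  have hdom : ∀ y, ∃ x, y ∈ highDeg G (s + 1) → x ∈ D ∧ (x = y ∨ G.Adj y x) := fun y => by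
    by_cases hy : y ∈ highDeg G (s + 1)
    · obtain ⟨x, hx⟩ := hDdom y hy
      exact ⟨x, fun _ => hx⟩
    · exact ⟨y, fun h => absurd h hy⟩
  choose f hf using hdom
  set H := hubs G cost (s + 1) D offset with hH
  set O := ownHubs G (s + 1) (radius (s + 1)) f with hO
  have hHcard : ∀ u, (H u).ncard * (s + 1) ≤ 21 * (n * (Nat.log 2 (s + 1) + 1)) :=
    fun u => ncard_hubs_mul_le hn hs hDcard u (hlay u)
  have hOcard : ∀ u, (O u).ncard ≤ 2 ^ (5 * (s + 1)) := ncard_ownHubs_le_two_pow f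
  have hvalid : ∀ u, (content G cost H O u).Valid (schemeParams n s) :=
    fun u => valid_content_graph hc hs u (hHcard u) (hOcard u)
  -- The decoder finds a vertex of `O v` that lies in `H u`; this inclusion makes it a common hub.
  have hOH : ∀ v, O v ⊆ H v := ownHubs_subset_hubs (cost := cost) (D := D) hf
  refine ⟨fun u => (content G cost H O u).label (schemeParams n s), D, offset, fun u => ?_, hDdom,
    fun u => ⟨hoff u, hlay u⟩, fun u => ?_, fun u v => ?_⟩
  · have h := length_label_mul_le hn hs (d := content G cost H O u)
      ((Nat.mul_le_mul_right _ (card_content_P_le u)).trans (hHcard u))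
      ((length_content_items_le u).trans (hOcard u))
    rw [← Content.length_label] at h
    have h' : (((content G cost H O u).label (schemeParams n s)).length : ℝ) * (s + 1 : ℕ) ≤
        40000 * (n * ((Nat.log 2 (s + 1) + 1 : ℕ) : ℝ) ^ 2) := by exact_mod_cast h
    rw [← mul_div_assoc, le_div_iff₀ (by linarith)]
    calc _ ≤ (((content G cost H O u).label (schemeParams n s)).length : ℝ) *
          (16 * (s + 1 : ℕ)) := by gcongr
      _ = 16 * ((((content G cost H O u).label (schemeParams n s)).length : ℝ) * (s + 1 : ℕ)) := by
          ring
      _ ≤ 16 * (40000 * (n * (3 * lg (lg T)) ^ 2)) :=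
          mul_le_mul_of_nonneg_left (h'.trans (by gcongr)) (by norm_num)
      _ = 5760000 * (n * lg (lg T) ^ 2) := by ring
      _ ≤ _ := by gcongr; norm_num
  · have h : ((H u).ncard : ℝ) * (s + 1 : ℕ) ≤ 21 * (n * ((Nat.log 2 (s + 1) + 1 : ℕ) : ℝ)) := by
      exact_mod_cast hHcard u
    rw [← mul_div_assoc, le_div_iff₀ (by linarith)]
    calc _ ≤ ((H u).ncard : ℝ) * (16 * (s + 1 : ℕ)) := by gcongr
      _ = 16 * (((H u).ncard : ℝ) * (s + 1 : ℕ)) := by ring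
      _ ≤ 16 * (21 * (n * (3 * lg (lg T)))) :=
          mul_le_mul_of_nonneg_left (h.trans (by gcongr)) (by norm_num)
      _ = 1008 * (n * lg (lg T)) := by ring
      _ ≤ _ := by gcongr; norm_num
  · by_cases hr : G.Reachable u v
    · obtain ⟨x, hxO, hxH, -, hx⟩ := exists_hub (D := D) (offset := offset) hc hf (hoff u) hr
      have hreach : ∀ w ∈ O v, G.Reachable v w := by
        rintro w (⟨p, -, -⟩ | ⟨y, ⟨hy, hyv⟩, rfl⟩)
        · exact ⟨p⟩
        · have h1 : G.Reachable v y := by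
            rcases hyv with rfl | ⟨z, ⟨p, -, -⟩, ha⟩
            · exact .refl _
            · exact SimpleGraph.Reachable.trans ⟨p⟩ ha.reachable
          rcases (hf y hy).2 with h | h
          · rwa [h]
          · exact h1.trans h.reachable
      obtain ⟨w, hwO, hwH, hmin, k, st, hk, hout⟩ := decode_content hvalid hr ⟨x, hxO, hxH⟩ hreach
      -- The lower bound is the triangle inequality through `w`; the upper bound compares the
      -- minimizer `w` with the hub `x`.
      exact ⟨_, ⟨k, st, hk.trans (htime _ (hOcard v)), hout⟩, delta_triangle u w v,
        (hmin x hxO hxH).trans hx, fun _ => ⟨w, ⟨hwH, hOH v hwO⟩, rfl⟩⟩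
    · have hne : (content G cost H O u).comp ≠ (content G cost H O v).comp := fun h =>
        hr (reachable_of_root_eq G (Fin.ext h))
      obtain ⟨k, st, hk, hout⟩ := (hvalid u).decode_ne (hvalid v) hne
      exact ⟨⊤, ⟨k, st, hk.trans (le_trans (by norm_num) (le_max_left _ _)), hout⟩, le_top,
        by simp [delta_eq_top hr], fun h => absurd h hr⟩
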